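/- Let $K$ be a field, $m,n\ge 0$, and let $R=K[x_0,\dots,x_m,y_0,\dots,y_n]$ be bigraded by giving each $x_i$ bidegree $(1,0)$ and each $y_j$ bidegree $(0,1)$. Write $(x)=(x_0,\dots,x_m)$, $(y)=(y_0,\dots,y_n)$, $(x,y)=(x)+(y)$ and $(xy)=(x_iy_j)_{i,j}$. For a bigraded $R$-module $M=\bigoplus_{(k,k')\in\mathbb Z^2}M_{k,k'}$ (not necessarily finitely generated) let $M^\sharp$ be $M$ regarded as a $\mathbb Z$-graded module by total degree, $M^\sharp_d=\bigoplus_{k+k'=d}M_{k,k'}$. Let $H^i_I(\cdot)$ denote local cohomology with support in $I$, with its natural (bi)grading. For $p,p'\in\mathbb Z$ and an integer $i$ put $St_i=\{(r,s)\in\mathbb Z^2: r+s=-i-1,\ r<0,\ s<0\}$ if $i>0$, and $St_i=\{(r,s)\in\mathbb Z^2: r+s=-i,\ r\ge 0,\ s\ge 0\}$ if $i\le 0$. Put $Reg_i(p,p')=\mathbb Z_{\ge 0}^2+(p,p')+St_i$ for $i\ge 0$ and $Reg_{-1}(p,p')=\mathbb Z_{\ge 0}^2+(p+1,p'+1)$.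 For an integer $d\ge 0$, $M$ satisfies $VC_d(p,p')$ if for all $i\ge 0$ and all $(k,k')\in\mathbb Z^2$: - $H^i_{(x)}(M)_{k,k'}=0$ whenever $k\ge p+d+1-i$; - $H^i_{(y)}(M)_{k,k'}=0$ whenever $k'\ge p'+d+1-i$; - $H^i_{(x,y)}(M^\sharp)_{k+k'}=0$ whenever $k+k'\ge p+p'+d+1-i$. $M$ is strongly $(p,p')$-regular if it satisfies $VC_0(p,p')$. $M$ is weakly $(p,p')$-regular if $H^i_{(xy)}(M)_{k,k'}=0$ for all $i\ge 0$ and all $(k,k')\in Reg_{i-1}(p,p')$. **Statement.** Let $M$ be a bigraded $R$-module and $p,p'\in\mathbb Z$. 1. For every $d\ge 0$, if $M$ satisfies $VC_d(p,p')$, then (a) $H^i_{(xy)}(M)_{k,k'}=0$ for all $0\le i\le d+2$ and all $(k,k')\in Reg_0(p+d+1-i,\,p'+d+1-i)$; and (b) $H^i_{(xy)}(M)_{k,k'}=0$ for all $i\ge d+2$ and all $(k,k')\in Reg_{i-d-1}(p,p')$. 2. If $M$ is strongly $(p,p')$-regular, then $M$ is weakly $(p,p')$-regular. -/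

import Mathlib

open CategoryTheory CategoryTheory.Limits

universe u

noncomputable section

/-! ### Criterion for an internal direct sum -/

/-- Additive subgroups which generate, and which are separated by additive projections, form an
internal direct sum. -/
theorem isInternal_of_proj {Γ : Type*} [DecidableEq Γ] {M : Type*} [AddCommGroup M]
    (ℳ : Γ → AddSubgroup M) (hgen : ∀ x, x ∈ ⨆ i, ℳ i) (π : Γ → M →+ M)
    (h1 : ∀ i x, x ∈ ℳ i → π i x = x) (h2 : ∀ i j x, i ≠ j → x ∈ ℳ j → π i x = 0) :
    DirectSum.IsInternal ℳ := by
  have key : ∀ (f : DirectSum Γ fun i => ℳ i) (i : Γ),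
      π i (DirectSum.coeAddMonoidHom ℳ f) = f i := by
    intro f i
    induction f using DirectSum.induction_on with
    | zero => simp
    | of j x =>
      rw [DirectSum.coeAddMonoidHom_of]
      by_cases hij : i = j
      · subst hij
        rw [h1 i _ x.2, DirectSum.of_eq_same]
      · rw [h2 i j _ hij x.2, DirectSum.of_eq_of_ne _ _ _ hij]
        rfl
    | add a b ha hb => simp only [map_add, ha, hb, DirectSum.add_apply, AddSubgroup.coe_add]
  constructor
  · rw [injective_iff_map_eq_zero]
    intro f hf
    refine DFinsupp.ext fun i => Subtype.ext ?_
    have := key f i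
    rw [hf, map_zero] at this
    exact this.symm
  · intro x
    refine AddSubgroup.iSup_induction ℳ (C := fun x => ∃ f, DirectSum.coeAddMonoidHom ℳ f = x)
      (hgen x) ?_ ?_ ?_
    · intro i y hy
      exact ⟨DirectSum.of (fun i => ℳ i) i ⟨y, hy⟩, DirectSum.coeAddMonoidHom_of ℳ i ⟨y, hy⟩⟩
    · exact ⟨0, map_zero _⟩
    · rintro a b ⟨f, rfl⟩ ⟨g, rfl⟩
      exact ⟨f + g, map_add _ f g⟩

/-! ### The abelian category of graded modules over a graded ring -/

section GradedModules

variable {A : Type*} {Γ : Type} {R : Type u} [CommRing A] [CommRing R] [Algebra A R]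
  [AddCommGroup Γ] [DecidableEq Γ]

/-- A `Γ`-graded module over a ring `R` with grading `𝒜`: an `R`-module `M` which is the internal
direct sum of additive subgroups `M_i`, `i ∈ Γ`, with `𝒜_i M_j ⊆ M_{i+j}`. -/
structure GrMod (𝒜 : Γ → Submodule A R) where
  carrier : Type u
  [addCommGroup : AddCommGroup carrier]
  [module : Module R carrier]
  /-- The homogeneous component of degree `i`. -/
  piece : Γ → AddSubgroup carrier
  isInternal : DirectSum.IsInternal piece
  smul_mem : ∀ {i j : Γ} {r : R} {x : carrier}, r ∈ 𝒜 i → x ∈ piece j → r • x ∈ piece (i + j)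

namespace GrMod

variable {𝒜 : Γ → Submodule A R}

instance : CoeSort (GrMod 𝒜) (Type u) := ⟨GrMod.carrier⟩

attribute [instance] GrMod.addCommGroup GrMod.module

/-- A morphism of graded modules: an `R`-linear map which is homogeneous of degree `0`. -/
@[ext]
structure Hom (M N : GrMod 𝒜) where
  toLin : M →ₗ[R] N
  map_mem : ∀ {i : Γ} {x : M}, x ∈ M.piece i → toLin x ∈ N.piece i

instance : Category (GrMod 𝒜) where
  Hom M N := Hom M N
  id M := ⟨LinearMap.id, fun h => h⟩
  comp f g := ⟨g.toLin ∘ₗ f.toLin, fun h => g.map_mem (f.map_mem h)⟩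

/-- The underlying linear map of a morphism. -/
def lin {M N : GrMod 𝒜} (f : M ⟶ N) : M →ₗ[R] N := Hom.toLin f

theorem lin_mem {M N : GrMod 𝒜} (f : M ⟶ N) {i : Γ} {x : M} (h : x ∈ M.piece i) :
    lin f x ∈ N.piece i := Hom.map_mem f h

/-- The morphism given by a linear map homogeneous of degree `0`. -/
def mkHom {M N : GrMod 𝒜} (f : M →ₗ[R] N)
    (h : ∀ (i : Γ) (x : M), x ∈ M.piece i → f x ∈ N.piece i) : M ⟶ N :=
  (⟨f, fun hx => h _ _ hx⟩ : Hom M N)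

@[simp] theorem lin_mkHom {M N : GrMod 𝒜} (f : M →ₗ[R] N) (h) : lin (mkHom f h : M ⟶ N) = f := rfl
@[simp] theorem lin_id (M : GrMod 𝒜) : lin (𝟙 M) = LinearMap.id := rfl
@[simp] theorem lin_comp {M N P : GrMod 𝒜} (f : M ⟶ N) (g : N ⟶ P) :
    lin (f ≫ g) = lin g ∘ₗ lin f := rfl

theorem lin_injective {M N : GrMod 𝒜} : Function.Injective (lin : (M ⟶ N) → (M →ₗ[R] N)) :=
  fun _ _ h => Hom.ext h

theorem hom_ext' {M N : GrMod 𝒜} {f g : M ⟶ N} (h : ∀ x, lin f x = lin g x) : f = g :=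
  lin_injective (LinearMap.ext h)

instance (M N : GrMod 𝒜) : Zero (M ⟶ N) := ⟨mkHom 0 fun _ _ _ => AddSubgroup.zero_mem _⟩
instance (M N : GrMod 𝒜) : Add (M ⟶ N) :=
  ⟨fun f g => mkHom (lin f + lin g) fun _ _ h =>
    AddSubgroup.add_mem _ (lin_mem f h) (lin_mem g h)⟩
instance (M N : GrMod 𝒜) : Neg (M ⟶ N) :=
  ⟨fun f => mkHom (-lin f) fun _ _ h => AddSubgroup.neg_mem _ (lin_mem f h)⟩
instance (M N : GrMod 𝒜) : Sub (M ⟶ N) :=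
  ⟨fun f g => mkHom (lin f - lin g) fun _ _ h =>
    AddSubgroup.sub_mem _ (lin_mem f h) (lin_mem g h)⟩
instance (M N : GrMod 𝒜) : SMul ℕ (M ⟶ N) :=
  ⟨fun n f => mkHom (n • lin f) fun _ _ h => AddSubgroup.nsmul_mem _ (lin_mem f h) n⟩
instance (M N : GrMod 𝒜) : SMul ℤ (M ⟶ N) :=
  ⟨fun n f => mkHom (n • lin f) fun _ _ h => AddSubgroup.zsmul_mem _ (lin_mem f h) n⟩

instance (M N : GrMod 𝒜) : AddCommGroup (M ⟶ N) :=
  lin_injective.addCommGroup (lin : (M ⟶ N) → (M →ₗ[R] N)) rfl (fun _ _ => rfl) (fun _ => rfl)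
    (fun _ _ => rfl) (fun _ _ => rfl) (fun _ _ => rfl)

@[simp] theorem lin_zero (M N : GrMod 𝒜) : lin (0 : M ⟶ N) = 0 := rfl
@[simp] theorem lin_add {M N : GrMod 𝒜} (f g : M ⟶ N) : lin (f + g) = lin f + lin g := rfl

instance : Preadditive (GrMod 𝒜) where
  add_comp _ _ _ f f' g := by
    apply lin_injective
    simp only [lin_comp, lin_add, LinearMap.comp_add]
  comp_add _ _ _ f g g' := by
    apply lin_injective
    simp only [lin_comp, lin_add, LinearMap.add_comp]

/-- The projection of a graded module onto its component of degree `i`. -/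
def proj (M : GrMod 𝒜) (i : Γ) : M →+ M :=
  ((M.piece i).subtype.comp (DFinsupp.evalAddMonoidHom i)).comp
    (AddEquiv.ofBijective (DirectSum.coeAddMonoidHom M.piece) M.isInternal).symm.toAddMonoidHom

theorem proj_mem (M : GrMod 𝒜) (i : Γ) (x : M) : M.proj i x ∈ M.piece i :=
  SetLike.coe_mem _

theorem symm_coe (M : GrMod 𝒜) {i : Γ} {x : M} (h : x ∈ M.piece i) :
    (AddEquiv.ofBijective (DirectSum.coeAddMonoidHom M.piece) M.isInternal).symm x
      = DirectSum.of (fun i => M.piece i) i ⟨x, h⟩ := by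
  rw [AddEquiv.symm_apply_eq]
  exact (DirectSum.coeAddMonoidHom_of M.piece i ⟨x, h⟩).symm

theorem proj_same (M : GrMod 𝒜) (i : Γ) (x : M) (h : x ∈ M.piece i) : M.proj i x = x := by
  have := congrArg (fun f => ((f i : M.piece i) : M)) (symm_coe M h)
  simp only [DirectSum.of_eq_same] at this
  exact this

theorem proj_ne (M : GrMod 𝒜) (i j : Γ) (x : M) (hij : i ≠ j) (h : x ∈ M.piece j) :
    M.proj i x = 0 := by
  have := congrArg (fun f => ((f i : M.piece i) : M)) (symm_coe M h)
  simp only [DirectSum.of_eq_of_ne _ _ _ hij] at this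
  exact this

theorem mem_iSup_piece (M : GrMod 𝒜) (x : M) : x ∈ ⨆ i, M.piece i := by
  obtain ⟨f, rfl⟩ := M.isInternal.2 x
  induction f using DirectSum.induction_on with
  | zero => rw [map_zero]; exact AddSubgroup.zero_mem _
  | of j x =>
    rw [DirectSum.coeAddMonoidHom_of]
    exact AddSubgroup.mem_iSup_of_mem j x.2
  | add a b ha hb => rw [map_add]; exact AddSubgroup.add_mem _ ha hb

/-- Induction on elements of a graded module. -/
theorem induction {M : GrMod 𝒜} {p : M → Prop} (x : M) (h0 : p 0)
    (h1 : ∀ i x, x ∈ M.piece i → p x) (h2 : ∀ x y, p x → p y → p (x + y)) : p x :=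
  AddSubgroup.iSup_induction M.piece (C := p) (M.mem_iSup_piece x) h1 h0 h2

/-- An element is the sum of its components. -/
theorem exists_sum_proj (M : GrMod 𝒜) (x : M) : ∃ s : Finset Γ, x = ∑ i ∈ s, M.proj i x ∧
    ∀ i, i ∉ s → M.proj i x = 0 := by
  set e := AddEquiv.ofBijective (DirectSum.coeAddMonoidHom M.piece) M.isInternal
  classical
  refine ⟨DFinsupp.support (e.symm x), ?_, ?_⟩
  · have h : e (e.symm x) = x := e.apply_symm_apply x
    conv_lhs => rw [← h]
    change DirectSum.coeAddMonoidHom M.piece (e.symm x) = _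
    rw [DirectSum.coeAddMonoidHom_eq_dfinsuppSum]
    rfl
  · intro i hi
    have := DFinsupp.notMem_support_iff.mp hi
    change ((e.symm x i : M.piece i) : M) = 0
    rw [this]
    rfl

theorem map_proj {M N : GrMod 𝒜} (f : M ⟶ N) (i : Γ) (x : M) :
    lin f (M.proj i x) = N.proj i (lin f x) := by
  induction x using GrMod.induction with
  | h0 => simp
  | h1 j x hx =>
    by_cases hij : i = j
    · subst hij
      rw [proj_same _ _ _ hx, proj_same _ _ _ (lin_mem f hx)]
    · rw [proj_ne _ _ _ _ hij hx, proj_ne _ _ _ _ hij (lin_mem f hx), map_zero]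
  | h2 x y hx hy => simp only [map_add, hx, hy]

/-- A homogeneous submodule, as a graded module. -/
def sub (M : GrMod 𝒜) (P : Submodule R M) (hP : ∀ x ∈ P, ∀ i, M.proj i x ∈ P) : GrMod 𝒜 where
  carrier := P
  piece i := (M.piece i).comap P.toAddSubgroup.subtype
  isInternal := by
    refine isInternal_of_proj _ ?_
      (fun i => ((M.proj i).comp P.toAddSubgroup.subtype).codRestrict P.toAddSubgroup
        fun x => hP x x.2 i) ?_ ?_
    · intro x
      obtain ⟨s, hs, -⟩ := M.exists_sum_proj x
      have : x = ∑ i ∈ s, (⟨M.proj i x, hP x x.2 i⟩ : P) := by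
        apply Subtype.ext
        rw [AddSubmonoidClass.coe_finsetSum]
        exact hs
      rw [this]
      exact AddSubgroup.sum_mem _ fun i _ => AddSubgroup.mem_iSup_of_mem i (M.proj_mem i x)
    · intro i x hx
      exact Subtype.ext (M.proj_same i x hx)
    · intro i j x hij hx
      exact Subtype.ext (M.proj_ne i j x hij hx)
  smul_mem := fun hr hx => M.smul_mem hr hx

/-- The quotient by a homogeneous submodule, as a graded module: the component of degree `i` is
the image of the component of degree `i`. -/
def quot (M : GrMod 𝒜) (P : Submodule R M) (hP : ∀ x ∈ P, ∀ i, M.proj i x ∈ P) : GrMod 𝒜 where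
  carrier := M ⧸ P
  piece i := (M.piece i).map P.mkQ.toAddMonoidHom
  isInternal := by
    refine isInternal_of_proj _ ?_
      (fun i => QuotientAddGroup.map P.toAddSubgroup P.toAddSubgroup (M.proj i)
        fun x hx => hP x hx i) ?_ ?_
    · intro x
      obtain ⟨x, rfl⟩ := P.mkQ_surjective x
      induction x using GrMod.induction with
      | h0 => rw [map_zero]; exact AddSubgroup.zero_mem _
      | h1 i x hx => exact AddSubgroup.mem_iSup_of_mem i ⟨x, hx, rfl⟩
      | h2 x y hx hy => rw [map_add]; exact AddSubgroup.add_mem _ hx hy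
    · rintro i _ ⟨x, hx, rfl⟩
      exact congrArg P.mkQ (M.proj_same i x hx)
    · rintro i j _ hij ⟨x, hx, rfl⟩
      exact (congrArg P.mkQ (M.proj_ne i j x hij hx)).trans (map_zero _)
  smul_mem := by
    rintro i j r _ hr ⟨x, hx, rfl⟩
    exact ⟨r • x, M.smul_mem hr hx, map_smul P.mkQ r x⟩

/-- The twist `M(γ)`, with `M(γ)_i = M_{γ + i}`. -/
def twist (M : GrMod 𝒜) (γ : Γ) : GrMod 𝒜 where
  carrier := M
  piece i := M.piece (γ + i)
  isInternal := by
    refine isInternal_of_proj _ ?_ (fun i => M.proj (γ + i)) (fun i x hx => M.proj_same _ x hx)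
      (fun i j x hij hx => M.proj_ne _ _ x (fun h => hij (add_left_cancel h)) hx)
    intro x
    induction x using GrMod.induction with
    | h0 => exact AddSubgroup.zero_mem _
    | h1 i x hx =>
      refine AddSubgroup.mem_iSup_of_mem (i - γ) ?_
      rwa [add_sub_cancel]
    | h2 x y hx hy => exact AddSubgroup.add_mem _ hx hy
  smul_mem := by
    intro i j r x hr hx
    have := M.smul_mem hr hx
    rwa [add_left_comm] at this

/-- The direct sum of two graded modules. -/
def prod (M N : GrMod 𝒜) : GrMod 𝒜 where
  carrier := M × N
  piece i := (M.piece i).prod (N.piece i)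
  isInternal := by
    refine isInternal_of_proj _ ?_ (fun i => (M.proj i).prodMap (N.proj i))
      (fun i x hx => Prod.ext (M.proj_same _ _ hx.1) (N.proj_same _ _ hx.2))
      (fun i j x hij hx => Prod.ext (M.proj_ne _ _ _ hij hx.1) (N.proj_ne _ _ _ hij hx.2))
    rintro ⟨x, y⟩
    have hx : ((x, 0) : M × N) ∈ ⨆ i, (M.piece i).prod (N.piece i) := by
      induction x using GrMod.induction with
      | h0 => exact AddSubgroup.zero_mem _
      | h1 i x hx => exact AddSubgroup.mem_iSup_of_mem i ⟨hx, AddSubgroup.zero_mem _⟩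
      | h2 x y hx hy =>
        have := AddSubgroup.add_mem _ hx hy
        simpa using this
    have hy : ((0, y) : M × N) ∈ ⨆ i, (M.piece i).prod (N.piece i) := by
      induction y using GrMod.induction with
      | h0 => exact AddSubgroup.zero_mem _
      | h1 i x hx => exact AddSubgroup.mem_iSup_of_mem i ⟨AddSubgroup.zero_mem _, hx⟩
      | h2 x y hx hy =>
        have := AddSubgroup.add_mem _ hx hy
        simpa using this
    have := AddSubgroup.add_mem _ hx hy
    simpa using this
  smul_mem := fun hr hx => ⟨M.smul_mem hr hx.1, N.smul_mem hr hx.2⟩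

instance : HasZeroObject (GrMod 𝒜) := by
  refine ⟨⟨{ carrier := PUnit, piece := fun _ => ⊥, isInternal := ?_, smul_mem := ?_ }, ?_⟩⟩
  · exact isInternal_of_proj _ (fun x => AddSubgroup.zero_mem _) (fun _ => 0)
      (fun _ _ _ => rfl) (fun _ _ _ _ _ => rfl)
  · intros
    exact AddSubgroup.zero_mem _
  · rw [IsZero.iff_id_eq_zero]
    exact hom_ext' fun x => rfl

instance (M N : GrMod 𝒜) : HasBinaryBiproduct M N :=
  HasBinaryBiproduct.mk
    { bicone :=
        { pt := M.prod N
          fst := mkHom (M := M.prod N) (N := M) (LinearMap.fst R M N) fun _ _ h => h.1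
          snd := mkHom (M := M.prod N) (N := N) (LinearMap.snd R M N) fun _ _ h => h.2
          inl := mkHom (M := M) (N := M.prod N) (LinearMap.inl R M N)
            fun _ _ h => ⟨h, AddSubgroup.zero_mem _⟩
          inr := mkHom (M := N) (N := M.prod N) (LinearMap.inr R M N)
            fun _ _ h => ⟨AddSubgroup.zero_mem _, h⟩
          inl_fst := rfl
          inl_snd := rfl
          inr_fst := rfl
          inr_snd := rfl }
      isBilimit := isBinaryBilimitOfTotal _ (hom_ext' fun x =>
        Prod.ext (add_zero x.1) (zero_add x.2)) }

instance : HasBinaryBiproducts (GrMod 𝒜) := ⟨fun _ _ => inferInstance⟩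

instance : HasFiniteProducts (GrMod 𝒜) :=
  hasFiniteProducts_of_has_binary_and_terminal

/-- The kernel of a morphism, as a graded module. -/
def ker {M N : GrMod 𝒜} (f : M ⟶ N) : GrMod 𝒜 :=
  M.sub (LinearMap.ker (lin f)) fun x hx i => by
    rw [LinearMap.mem_ker] at hx ⊢
    rw [map_proj, hx, map_zero]

/-- The cokernel of a morphism, as a graded module. -/
def coker {M N : GrMod 𝒜} (f : M ⟶ N) : GrMod 𝒜 :=
  N.quot (LinearMap.range (lin f)) fun x hx i => by
    obtain ⟨y, rfl⟩ := hx
    exact ⟨M.proj i y, map_proj f i y⟩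

/-- The inclusion of the kernel. -/
def kerι {M N : GrMod 𝒜} (f : M ⟶ N) : ker f ⟶ M :=
  mkHom (M := ker f) (LinearMap.ker (lin f)).subtype fun _ _ h => h

/-- The projection to the cokernel. -/
def cokerπ {M N : GrMod 𝒜} (f : M ⟶ N) : N ⟶ coker f :=
  mkHom (N := coker f) (LinearMap.range (lin f)).mkQ fun _ x h => ⟨x, h, rfl⟩

/-- An injective morphism is a kernel of any morphism whose kernel is its range. -/
def isLimitOfInjective {M N P : GrMod 𝒜} (f : M ⟶ N) (g : N ⟶ P)
    (hf : Function.Injective (lin f)) (w : f ≫ g = 0)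
    (hfg : LinearMap.ker (lin g) ≤ LinearMap.range (lin f)) :
    IsLimit (KernelFork.ofι f w) :=
  KernelFork.IsLimit.ofι f w
    (fun {Z} k hk => mkHom
      ((LinearEquiv.ofInjective (lin f) hf).symm.toLinearMap ∘ₗ
        (lin k).codRestrict (LinearMap.range (lin f))
          fun x => hfg (LinearMap.congr_fun (congrArg lin hk) x)) <| by
        intro i x hx
        set y := ((LinearEquiv.ofInjective (lin f) hf).symm.toLinearMap ∘ₗ
          (lin k).codRestrict (LinearMap.range (lin f))
            fun x => hfg (LinearMap.congr_fun (congrArg lin hk) x)) x with hy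
        have h : lin f y = lin k x :=
          congrArg Subtype.val ((LinearEquiv.ofInjective (lin f) hf).apply_symm_apply _)
        have : M.proj i y = y := hf (by
          rw [map_proj, h, proj_same _ _ _ (lin_mem k hx)])
        rw [← this]
        exact M.proj_mem i y)
    (fun {Z} k hk => hom_ext' fun x =>
      congrArg Subtype.val ((LinearEquiv.ofInjective (lin f) hf).apply_symm_apply _))
    (fun {Z} k hk m hm => hom_ext' fun x => hf <|
      (LinearMap.congr_fun (congrArg lin hm) x).trans
      (congrArg Subtype.val ((LinearEquiv.ofInjective (lin f) hf).apply_symm_apply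
        ⟨lin k x, hfg (LinearMap.congr_fun (congrArg lin hk) x)⟩)).symm)

/-- The linear map induced by `k` on the target of a surjection `g` with `ker g ≤ ker k`. -/
def descLin {N P Z : GrMod 𝒜} (g : N ⟶ P) (hg : Function.Surjective (lin g)) (k : N ⟶ Z)
    (h : LinearMap.ker (lin g) ≤ LinearMap.ker (lin k)) : P →ₗ[R] Z :=
  (LinearMap.ker (lin g)).liftQ (lin k) h ∘ₗ
    ((lin g).quotKerEquivOfSurjective hg).symm.toLinearMap

theorem descLin_apply {N P Z : GrMod 𝒜} (g : N ⟶ P) (hg : Function.Surjective (lin g)) (k : N ⟶ Z)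
    (h : LinearMap.ker (lin g) ≤ LinearMap.ker (lin k)) (x : N) :
    descLin g hg k h (lin g x) = lin k x := by
  have : ((lin g).quotKerEquivOfSurjective hg).symm (lin g x) =
      (LinearMap.ker (lin g)).mkQ x := by
    rw [LinearEquiv.symm_apply_eq]
    rfl
  change (LinearMap.ker (lin g)).liftQ (lin k) h
    (((lin g).quotKerEquivOfSurjective hg).symm (lin g x)) = _
  rw [this]
  rfl

/-- A surjective morphism is a cokernel of any morphism whose range is its kernel. -/
def isColimitOfSurjective {M N P : GrMod 𝒜} (f : M ⟶ N) (g : N ⟶ P)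
    (hg : Function.Surjective (lin g)) (w : f ≫ g = 0)
    (hfg : LinearMap.ker (lin g) ≤ LinearMap.range (lin f)) :
    IsColimit (CokernelCofork.ofπ g w) :=
  have hker : ∀ {Z : GrMod 𝒜} (k : N ⟶ Z), f ≫ k = 0 →
      LinearMap.ker (lin g) ≤ LinearMap.ker (lin k) := by
    intro Z k hk x hx
    obtain ⟨y, rfl⟩ := hfg hx
    exact LinearMap.congr_fun (congrArg lin hk) y
  CokernelCofork.IsColimit.ofπ g w
    (fun {Z} k hk => mkHom (descLin g hg k (hker k hk)) <| by
      intro i z hz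
      obtain ⟨x, rfl⟩ := hg z
      have : lin g x = lin g (N.proj i x) := by rw [map_proj, proj_same _ _ _ hz]
      rw [this, descLin_apply]
      exact lin_mem k (N.proj_mem i x))
    (fun {Z} k hk => hom_ext' fun x => descLin_apply g hg k (hker k hk) x)
    (fun {Z} k hk m hm => hom_ext' fun z => by
      obtain ⟨x, rfl⟩ := hg z
      exact (LinearMap.congr_fun (congrArg lin hm) x).trans
        (descLin_apply g hg k (hker k hk) x).symm)

theorem kerι_comp {M N : GrMod 𝒜} (f : M ⟶ N) : kerι f ≫ f = 0 :=
  hom_ext' fun x => LinearMap.mem_ker.mp x.2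

theorem comp_cokerπ {M N : GrMod 𝒜} (f : M ⟶ N) : f ≫ cokerπ f = 0 :=
  hom_ext' fun x => (Submodule.Quotient.mk_eq_zero _).mpr ⟨x, rfl⟩

theorem ker_lin_cokerπ {M N : GrMod 𝒜} (f : M ⟶ N) :
    LinearMap.ker (lin (cokerπ f)) = LinearMap.range (lin f) :=
  Submodule.ker_mkQ _

theorem range_lin_kerι {M N : GrMod 𝒜} (f : M ⟶ N) :
    LinearMap.range (lin (kerι f)) = LinearMap.ker (lin f) :=
  Submodule.range_subtype _

theorem injective_of_mono {M N : GrMod 𝒜} (f : M ⟶ N) [Mono f] : Function.Injective (lin f) := by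
  have h : kerι f = 0 := by rw [← cancel_mono f, kerι_comp, zero_comp]
  rw [← LinearMap.ker_eq_bot, ← range_lin_kerι, h]
  exact LinearMap.range_zero

theorem surjective_of_epi {M N : GrMod 𝒜} (f : M ⟶ N) [Epi f] : Function.Surjective (lin f) := by
  have h : cokerπ f = 0 := by rw [← cancel_epi f, comp_cokerπ, comp_zero]
  rw [← LinearMap.range_eq_top, ← ker_lin_cokerπ, h]
  exact LinearMap.ker_zero

instance : HasKernels (GrMod 𝒜) :=
  ⟨fun f => HasLimit.mk ⟨_, isLimitOfInjective (kerι f) f Subtype.val_injective (kerι_comp f)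
    (range_lin_kerι f).ge⟩⟩

instance : HasCokernels (GrMod 𝒜) :=
  ⟨fun f => HasColimit.mk ⟨_, isColimitOfSurjective f (cokerπ f) (Submodule.mkQ_surjective _)
    (comp_cokerπ f) (ker_lin_cokerπ f).le⟩⟩

instance : IsNormalMonoCategory (GrMod 𝒜) :=
  ⟨fun f _ => ⟨{
    Z := coker f
    g := cokerπ f
    w := comp_cokerπ f
    isLimit := isLimitOfInjective f (cokerπ f) (injective_of_mono f) (comp_cokerπ f)
      (ker_lin_cokerπ f).le }⟩⟩

instance : IsNormalEpiCategory (GrMod 𝒜) :=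
  ⟨fun f _ => ⟨{
    W := ker f
    g := kerι f
    w := kerι_comp f
    isColimit := isColimitOfSurjective (kerι f) f (surjective_of_epi f) (kerι_comp f)
      (range_lin_kerι f).ge }⟩⟩

instance : Abelian (GrMod 𝒜) where

instance : HasExt.{u + 1} (GrMod 𝒜) := HasExt.standard _

end GrMod

/-! ### Graded local cohomology -/

section LocalCohomology

variable {𝒜 : Γ → Submodule A R} [GradedRing 𝒜]

open GrMod

variable (𝒜) in
/-- The graded ring as a graded module over itself. -/
def GrMod.self : GrMod 𝒜 where
  carrier := R
  piece i := (𝒜 i).toAddSubgroup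
  isInternal := DirectSum.Decomposition.isInternal 𝒜
  smul_mem := fun hr hx => SetLike.mul_mem_graded hr hx

theorem GrMod.self_proj (i : Γ) (x : R) :
    (GrMod.self 𝒜).proj i x = (DirectSum.decompose 𝒜 x i : R) := by
  have h : (AddEquiv.ofBijective (DirectSum.coeAddMonoidHom (GrMod.self 𝒜).piece)
      (GrMod.self 𝒜).isInternal).symm x = DirectSum.decompose 𝒜 x :=
    (AddEquiv.symm_apply_eq _).mpr (DirectSum.Decomposition.left_inv (ℳ := 𝒜) x).symm
  exact congrArg (fun f : DirectSum Γ fun i => 𝒜 i => (f i : R)) h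

/-- The graded module `R/J` for a homogeneous ideal `J`. -/
def GrMod.ringQuot (J : HomogeneousIdeal 𝒜) : GrMod 𝒜 :=
  (GrMod.self 𝒜).quot J.toIdeal fun (x : R) hx i => by
    exact Set.mem_of_eq_of_mem (s := (J.toIdeal : Set R)) (GrMod.self_proj i x)
      (J.isHomogeneous i hx)

/-- The canonical surjection `R/J → R/J'` for `J ⊆ J'`. -/
def GrMod.ringQuotMap {J J' : HomogeneousIdeal 𝒜} (h : J.toIdeal ≤ J'.toIdeal) :
    GrMod.ringQuot J ⟶ GrMod.ringQuot J' :=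
  GrMod.mkHom (M := GrMod.ringQuot J) (N := GrMod.ringQuot J')
    (Submodule.mapQ J.toIdeal J'.toIdeal LinearMap.id h) <| by
      rintro i _ ⟨x, hx, rfl⟩
      exact ⟨x, hx, rfl⟩

/-- The powers of a homogeneous ideal. -/
def homogeneousPow (I : HomogeneousIdeal 𝒜) (n : ℕ) : HomogeneousIdeal 𝒜 :=
  ⟨I.toIdeal ^ n, by
    induction n with
    | zero => rw [pow_zero, Ideal.one_eq_top]; exact Ideal.IsHomogeneous.top 𝒜
    | succ n ih => rw [pow_succ]; exact Ideal.IsHomogeneous.mul ih I.isHomogeneous⟩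

/-- The inverse system `⋯ → R/I² → R/I → R/I⁰`, as a direct system in the opposite category. -/
def quotPowSystem (I : HomogeneousIdeal 𝒜) : ℕ ⥤ (GrMod 𝒜)ᵒᵖ where
  obj n := Opposite.op (GrMod.ringQuot (homogeneousPow I n))
  map {n n'} h := (GrMod.ringQuotMap (J := homogeneousPow I n') (J' := homogeneousPow I n)
    (Ideal.pow_le_pow_right (leOfHom h))).op
  map_id n := Quiver.Hom.unop_inj <| GrMod.hom_ext' fun x => by
    obtain ⟨x, rfl⟩ := Submodule.mkQ_surjective _ x
    rfl
  map_comp f g := Quiver.Hom.unop_inj <| GrMod.hom_ext' fun x => by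
    obtain ⟨x, rfl⟩ := Submodule.mkQ_surjective _ x
    rfl

/-- The component of degree `γ` of the graded local cohomology module,
`H^i_I(M)_γ = colim_n Ext^i(R/Iⁿ, M(γ))`, with `Ext` taken in the category of graded modules
(so that `Ext⁰(R/Iⁿ, M(γ)) = Hom(R/Iⁿ, M(γ))` is the group of homogeneous elements of `M` of degree
`γ` which are killed by `Iⁿ`). -/
def gradedLocalCohomology (I : HomogeneousIdeal 𝒜) (i : ℕ) (M : GrMod 𝒜) (γ : Γ) :
    AddCommGrpCat.{u + 1} :=
  colimit (quotPowSystem I ⋙ (Abelian.extFunctor (C := GrMod 𝒜) i).flip.obj (M.twist γ))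

end LocalCohomology

end GradedModules

/-! ### Bigraded modules over `K[x_0, …, x_m, y_0, …, y_n]` -/

section Bigraded

/-- The polynomial ring `R = K[x_0, …, x_m, y_0, …, y_n]`. -/
abbrev BiPoly (K : Type u) [Field K] (m n : ℕ) : Type u :=
  MvPolynomial (Fin (m + 1) ⊕ Fin (n + 1)) K

/-- The bidegrees of the variables: `(1, 0)` for `x_i` and `(0, 1)` for `y_j`. -/
def bidegree (m n : ℕ) : Fin (m + 1) ⊕ Fin (n + 1) → ℤ × ℤ :=
  Sum.elim (fun _ => (1, 0)) (fun _ => (0, 1))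

/-- The bigrading of `R`, indexed by `ℤ × ℤ`. -/
abbrev bigrading (K : Type u) [Field K] (m n : ℕ) : ℤ × ℤ → Submodule K (BiPoly K m n) :=
  MvPolynomial.weightedHomogeneousSubmodule K (bidegree m n)

/-- The grading of `R` by total degree, indexed by `ℤ`. -/
abbrev totalGrading (K : Type u) [Field K] (m n : ℕ) : ℤ → Submodule K (BiPoly K m n) :=
  MvPolynomial.weightedHomogeneousSubmodule K (fun _ => (1 : ℤ))

instance (K : Type u) [Field K] (m n : ℕ) : GradedAlgebra (bigrading K m n) :=
  MvPolynomial.weightedGradedAlgebra K (bidegree m n)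

instance (K : Type u) [Field K] (m n : ℕ) : GradedAlgebra (totalGrading K m n) :=
  MvPolynomial.weightedGradedAlgebra K _

/-- Bigraded `R`-modules. -/
abbrev BigradedModule (K : Type u) [Field K] (m n : ℕ) := GrMod (bigrading K m n)

variable {K : Type u} [Field K] {m n : ℕ}

variable (K m n) in
/-- The ideal `(x) = (x_0, …, x_m)`. -/
def idealX : HomogeneousIdeal (bigrading K m n) :=
  ⟨Ideal.span (Set.range fun i => MvPolynomial.X (Sum.inl i)),
    Ideal.homogeneous_span _ _ <| by
      rintro _ ⟨i, rfl⟩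
      exact ⟨_, MvPolynomial.isWeightedHomogeneous_X K _ _⟩⟩

variable (K m n) in
/-- The ideal `(y) = (y_0, …, y_n)`. -/
def idealY : HomogeneousIdeal (bigrading K m n) :=
  ⟨Ideal.span (Set.range fun j => MvPolynomial.X (Sum.inr j)),
    Ideal.homogeneous_span _ _ <| by
      rintro _ ⟨i, rfl⟩
      exact ⟨_, MvPolynomial.isWeightedHomogeneous_X K _ _⟩⟩

variable (K m n) in
/-- The irrelevant ideal `(xy) = (x_i y_j)`. -/
def idealXmulY : HomogeneousIdeal (bigrading K m n) :=
  ⟨Ideal.span (Set.range fun ij : Fin (m + 1) × Fin (n + 1) =>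
      MvPolynomial.X (Sum.inl ij.1) * MvPolynomial.X (Sum.inr ij.2)),
    Ideal.homogeneous_span _ _ <| by
      rintro _ ⟨ij, rfl⟩
      exact ⟨_, (MvPolynomial.isWeightedHomogeneous_X K _ _).mul
        (MvPolynomial.isWeightedHomogeneous_X K _ _)⟩⟩

variable (K m n) in
/-- The ideal `(x, y) = (x_0, …, x_m, y_0, …, y_n)`, homogeneous for the total degree. -/
def idealXandY : HomogeneousIdeal (totalGrading K m n) :=
  ⟨Ideal.span (Set.range MvPolynomial.X),
    Ideal.homogeneous_span _ _ <| by
      rintro _ ⟨i, rfl⟩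
      exact ⟨_, MvPolynomial.isWeightedHomogeneous_X K _ _⟩⟩

theorem weight_bidegree (s : Fin (m + 1) ⊕ Fin (n + 1) →₀ ℕ) :
    (Finsupp.weight (bidegree m n) s).1 + (Finsupp.weight (bidegree m n) s).2 =
      Finsupp.weight (fun _ => (1 : ℤ)) s := by
  induction s using Finsupp.induction_linear with
  | zero => simp
  | add a b ha hb =>
    simp only [map_add, Prod.fst_add, Prod.snd_add, ← ha, ← hb]
    ring
  | single i c => cases i <;> simp [Finsupp.weight_single, bidegree]

/-- The graded module `M^♯` over `R` with its total degree: `M^♯` is `M` as an `R`-module, and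
`M^♯_d = ⨁_{k + k' = d} M_{k, k'}`. -/
def GrMod.sharp (M : BigradedModule K m n) : GrMod (totalGrading K m n) where
  carrier := M
  piece d := ⨆ z : {z : ℤ × ℤ // z.1 + z.2 = d}, M.piece z
  isInternal := by
    let e := AddEquiv.ofBijective (DirectSum.coeAddMonoidHom M.piece) M.isInternal
    let π : ℤ → M →+ M := fun d =>
      (DirectSum.toAddMonoid fun z : ℤ × ℤ =>
        if z.1 + z.2 = d then (M.piece z).subtype else 0).comp e.symm.toAddMonoidHom
    have hπ : ∀ (d : ℤ) (z : ℤ × ℤ) (x : M), x ∈ M.piece z →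
        π d x = if z.1 + z.2 = d then x else 0 := by
      intro d z x hx
      have h1 : e.symm x = DirectSum.of (fun i => M.piece i) z ⟨x, hx⟩ := M.symm_coe hx
      change DirectSum.toAddMonoid (fun z : ℤ × ℤ =>
        if z.1 + z.2 = d then (M.piece z).subtype else 0) (e.symm x) = _
      rw [h1, DirectSum.toAddMonoid_of]
      split_ifs <;> rfl
    refine isInternal_of_proj _ ?_ π ?_ ?_
    · intro x
      induction x using GrMod.induction with
      | h0 => exact AddSubgroup.zero_mem _
      | h1 z x hx =>
        exact AddSubgroup.mem_iSup_of_mem (z.1 + z.2)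
          (AddSubgroup.mem_iSup_of_mem (⟨z, rfl⟩ : {w : ℤ × ℤ // w.1 + w.2 = z.1 + z.2}) hx)
      | h2 x y hx hy => exact AddSubgroup.add_mem _ hx hy
    · intro d x hx
      refine AddSubgroup.iSup_induction _ (C := fun x => π d x = x) hx ?_ (map_zero _) ?_
      · rintro ⟨z, hz⟩ x hx
        rw [hπ d z x hx, if_pos hz]
      · intro x y hx hy
        rw [map_add, hx, hy]
    · intro d d' x hd hx
      refine AddSubgroup.iSup_induction _ (C := fun x => π d x = 0) hx ?_ (map_zero _) ?_
      · rintro ⟨z, hz⟩ x hx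
        rw [hπ d z x hx, if_neg (fun h => hd (h.symm.trans hz))]
      · intro x y hx hy
        rw [map_add, hx, hy, add_zero]
  smul_mem := by
    intro a b r x hr hx
    refine AddSubgroup.iSup_induction _ (C := fun x => r • x ∈
      ⨆ z : {z : ℤ × ℤ // z.1 + z.2 = a + b}, M.piece z) hx ?_ ?_ ?_
    · rintro ⟨z, hz⟩ x hx
      rw [MvPolynomial.as_sum r, Finset.sum_smul]
      refine AddSubgroup.sum_mem _ fun s hs => ?_
      have hs' : Finsupp.weight (fun _ => (1 : ℤ)) s = a := hr (MvPolynomial.mem_support_iff.mp hs)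
      have h := M.smul_mem (MvPolynomial.isWeightedHomogeneous_monomial (bidegree m n) s
        (r.coeff s) rfl) hx
      refine AddSubgroup.mem_iSup_of_mem (⟨Finsupp.weight (bidegree m n) s + z, ?_⟩ :
        {z : ℤ × ℤ // z.1 + z.2 = a + b}) h
      rw [← hs', ← hz, ← weight_bidegree, Prod.fst_add, Prod.snd_add]
      ring
    · rw [smul_zero]
      exact AddSubgroup.zero_mem _
    · intro x y hx hy
      rw [smul_add]
      exact AddSubgroup.add_mem _ hx hy

/-! ### Regions and regularity -/

/-- The staircase `St_i`. -/
def St (i : ℤ) : Set (ℤ × ℤ) :=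
  if 0 < i then {z | z.1 + z.2 = -i - 1 ∧ z.1 < 0 ∧ z.2 < 0}
  else {z | z.1 + z.2 = -i ∧ 0 ≤ z.1 ∧ 0 ≤ z.2}

/-- `St_i(p, p') = (p, p') + St_i`. -/
def StAt (i p p' : ℤ) : Set (ℤ × ℤ) := {z | ∃ s ∈ St i, z = (p, p') + s}

/-- The region `Reg_i(p, p')`, `i ≥ -1`: it is `ℤ₊² + St_i(p, p')` for `i ≥ 0` and
`ℤ₊² + (p + 1, p' + 1)` for `i = -1`. -/
def Reg (i p p' : ℤ) : Set (ℤ × ℤ) :=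
  if 0 ≤ i then {z | ∃ a b : ℤ, 0 ≤ a ∧ 0 ≤ b ∧ ∃ s ∈ StAt i p p', z = (a, b) + s}
  else {z | ∃ a b : ℤ, 0 ≤ a ∧ 0 ≤ b ∧ z = (a, b) + (p + 1, p' + 1)}

/-- The vanishing condition `VC_d(p, p')`. -/
def SatisfiesVC (M : BigradedModule K m n) (d : ℕ) (p p' : ℤ) : Prop :=
  ∀ i : ℕ,
    (∀ k k' : ℤ, p + d + 1 - i ≤ k →
      Subsingleton (gradedLocalCohomology (idealX K m n) i M (k, k'))) ∧
    (∀ k k' : ℤ, p' + d + 1 - i ≤ k' →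
      Subsingleton (gradedLocalCohomology (idealY K m n) i M (k, k'))) ∧
    (∀ k k' : ℤ, p + p' + d + 1 - i ≤ k + k' →
      Subsingleton (gradedLocalCohomology (idealXandY K m n) i M.sharp (k + k')))

/-- Strong `(p, p')`-regularity. -/
def IsStronglyRegular (M : BigradedModule K m n) (p p' : ℤ) : Prop :=
  SatisfiesVC M 0 p p'

/-- Weak `(p, p')`-regularity. -/
def IsWeaklyRegular (M : BigradedModule K m n) (p p' : ℤ) : Prop :=
  ∀ i : ℕ, ∀ k k' : ℤ, (k, k') ∈ Reg ((i : ℤ) - 1) p p' →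
    Subsingleton (gradedLocalCohomology (idealXmulY K m n) i M (k, k'))

end Bigraded

end

/-! Since the ideals $(x)$ and $(y)$ involve disjoint variables, $(xy)^n=(x)^n\cap(y)^n$
(`idealXmulY_pow`), and the sums $(x)^n+(y)^n$ are cofinal with the powers of $(x,y)$. The sequences
$0\to R/(xy)^n\to R/(x)^n\oplus R/(y)^n\to R/((x)^n+(y)^n)\to 0$ therefore give the Mayer–Vietoris
segment $H^i_{(x)}\oplus H^i_{(y)}\to H^i_{(xy)}\to H^{i+1}_{(x,y)}$, so the middle term vanishes in
a bidegree where the outer ones do. The argument chases a single Ext class through this segment at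
finite stages (`subsingleton_of_mayerVietoris`); no long exact sequence of colimits is formed.

The delicate point is that the hypothesis on $(x,y)$ concerns $M^\sharp$, that is, Ext in the
category graded by total degree, whereas Mayer–Vietoris runs in the bigraded category. Regrading is
exact and injective on Ext (`eq_zero_of_mapExactFunctor_sharp`), so a bigraded class that dies after
regrading was already dead.

What remains is arithmetic (`SatisfiesVC.subsingleton`): the three bounds of $VC_d(p,p')$, the last
one taken at $i+1$, are $k\ge p+d+1-i$, $k'\ge p'+d+1-i$ and $k+k'\ge p+p'+d-i$. In (a) the third
follows from the first two because $i\le d+2$; in (b) all three are read off the staircase. -/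

noncomputable section

/-! ### Vanishing of sequential colimits of abelian groups -/

/-- A sequential colimit of abelian groups vanishes if and only if every element dies at a later
stage. -/
theorem subsingleton_colimit_iff
    (F : ℕ ⥤ AddCommGrpCat.{u}) :
    Subsingleton ↑(colimit F) ↔
      ∀ (n : ℕ) (x : F.obj n), ∃ (k : ℕ) (h : n ⟶ k), F.map h x = 0 := by
  -- The index category `ℕ` lives in universe `0`, while the forgetful functor is known to preserve
  -- filtered colimits of size `u`.
  have : PreservesFilteredColimitsOfSize.{0, 0} (forget AddCommGrpCat.{u}) :=
    preservesFilteredColimitsOfSize_shrink.{0, u, 0, u} _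
  have : PreservesColimit F (forget AddCommGrpCat.{u}) := inferInstance
  constructor
  · intro hs n x
    obtain ⟨k, e, e', h⟩ := Concrete.colimit_exists_of_rep_eq F (i := n) (j := n) x 0
      (Subsingleton.elim _ _)
    exact ⟨k, e, h.trans (map_zero _)⟩
  · intro h
    refine subsingleton_of_forall_eq 0 fun c => ?_
    obtain ⟨n, x, rfl⟩ := Concrete.colimit_exists_rep F c
    obtain ⟨k, e, hk⟩ := h n x
    rw [← colimit.w F e]
    change colimit.ι F k (F.map e x) = 0
    rw [hk, map_zero]

namespace GrMod

/-! ### Exactness of graded modules read off the underlying linear maps. -/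

section Exactness

variable {A : Type*} {Γ : Type} {R : Type u} [CommRing A] [CommRing R] [Algebra A R]
  [AddCommGroup Γ] [DecidableEq Γ] {𝒜 : Γ → Submodule A R}

theorem mono_of_injective {M N : GrMod 𝒜} (f : M ⟶ N) (h : Function.Injective (lin f)) :
    Mono f :=
  ⟨fun _ _ hab => hom_ext' fun x => h (LinearMap.congr_fun (congrArg lin hab) x)⟩

theorem epi_of_surjective {M N : GrMod 𝒜} (f : M ⟶ N) (h : Function.Surjective (lin f)) :
    Epi f :=
  ⟨fun _ _ hab => hom_ext' fun x => by
    obtain ⟨x, rfl⟩ := h x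
    exact LinearMap.congr_fun (congrArg lin hab) x⟩

theorem shortExact_of_lin (S : ShortComplex (GrMod 𝒜)) (hf : Function.Injective (lin S.f))
    (hg : Function.Surjective (lin S.g))
    (h : LinearMap.ker (lin S.g) ≤ LinearMap.range (lin S.f)) : S.ShortExact where
  exact := ShortComplex.exact_of_f_is_kernel _ (isLimitOfInjective S.f S.g hf S.zero h)
  mono_f := mono_of_injective _ hf
  epi_g := epi_of_surjective _ hg

theorem ker_le_range_of_shortExact {S : ShortComplex (GrMod 𝒜)} (hS : S.ShortExact) :
    LinearMap.ker (lin S.g) ≤ LinearMap.range (lin S.f) := by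
  intro x hx
  have := hS.mono_f
  have h := hS.exact.lift_f (kerι S.g) (kerι_comp S.g)
  exact ⟨_, LinearMap.congr_fun (congrArg lin h) ⟨x, hx⟩⟩

end Exactness

/-! ### Regrading by total degree is an exact functor. -/

section Sharp

variable {K : Type u} [Field K] {m n : ℕ}

theorem piece_le_sharp_piece (M : BigradedModule K m n) (z : ℤ × ℤ) :
    M.piece z ≤ M.sharp.piece (z.1 + z.2) :=
  le_iSup (fun w : {w : ℤ × ℤ // w.1 + w.2 = z.1 + z.2} => M.piece w) ⟨z, rfl⟩

theorem sharp_piece_le {M : BigradedModule K m n} {d : ℤ} {P : AddSubgroup M}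
    (h : ∀ z : ℤ × ℤ, z.1 + z.2 = d → M.piece z ≤ P) : M.sharp.piece d ≤ P :=
  iSup_le fun z => h z z.2

theorem sharp_lin_mem {M N : BigradedModule K m n} (f : M ⟶ N) {d : ℤ} {x : M}
    (hx : x ∈ M.sharp.piece d) : lin f x ∈ N.sharp.piece d :=
  sharp_piece_le (P := AddSubgroup.comap (lin f).toAddMonoidHom (N.sharp.piece d))
    (fun z hz y hy => by subst hz; exact piece_le_sharp_piece N z (lin_mem f hy)) hx

/-- A morphism of bigraded modules, as a morphism for the total degree. -/
def sharpMap {M N : BigradedModule K m n} (f : M ⟶ N) : M.sharp ⟶ N.sharp :=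
  mkHom (M := M.sharp) (N := N.sharp) (lin (M := M) (N := N) f) fun _ _ hx => sharp_lin_mem f hx

/-- Regrading by total degree, as a functor. -/
def sharpFunctor (K : Type u) [Field K] (m n : ℕ) :
    BigradedModule K m n ⥤ GrMod (totalGrading K m n) where
  obj M := M.sharp
  map f := sharpMap f
  map_id _ := hom_ext' fun _ => rfl
  map_comp _ _ := hom_ext' fun _ => rfl

instance : (sharpFunctor K m n).Additive where
  map_add := rfl

/-- Regrading leaves the underlying linear maps untouched, and short exactness depends only on
these. -/
theorem sharpFunctor_exact :
    PreservesFiniteLimits (sharpFunctor K m n) ∧ PreservesFiniteColimits (sharpFunctor K m n) := by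
  refine ((sharpFunctor K m n).exact_tfae.out 0 3).mp fun S hS => ?_
  have := hS.mono_f
  have := hS.epi_g
  exact shortExact_of_lin _ (by exact injective_of_mono S.f) (by exact surjective_of_epi S.g)
    (by exact ker_le_range_of_shortExact (S := S) hS)

instance : PreservesFiniteLimits (sharpFunctor K m n) := sharpFunctor_exact.1

instance : PreservesFiniteColimits (sharpFunctor K m n) := sharpFunctor_exact.2

end Sharp

end GrMod

namespace GrMod

section Projectives

variable {A : Type*} {Γ : Type} {R : Type u} [CommRing A] [CommRing R] [Algebra A R]
  [AddCommGroup Γ] [DecidableEq Γ] {𝒜 : Γ → Submodule A R}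

/-! ### Homogeneous components of linear maps -/

theorem proj_smul (M : GrMod 𝒜) {w : Γ} {r : R} (hr : r ∈ 𝒜 w) (d : Γ) (x : M) :
    M.proj (w + d) (r • x) = r • M.proj d x := by
  induction x using GrMod.induction with
  | h0 => simp
  | h1 j x hx =>
    by_cases h : d = j
    · subst h
      rw [proj_same _ _ _ hx, proj_same _ _ _ (M.smul_mem hr hx)]
    · rw [proj_ne _ _ _ _ h hx, smul_zero,
        proj_ne _ _ _ _ (fun h' => h (add_left_cancel h')) (M.smul_mem hr hx)]
  | h2 x y hx hy => simp only [smul_add, map_add, hx, hy]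

theorem mem_piece_of_proj_eq {M : GrMod 𝒜} {d : Γ} {x : M} (h : M.proj d x = x) :
    x ∈ M.piece d := h ▸ M.proj_mem d x

/-- The additive map which on the component of degree `z` is the component of degree `z` of
`h`. -/
def degreeZeroAddHom {M N : GrMod 𝒜} (h : M →ₗ[R] N) : M →+ N :=
  (DirectSum.toAddMonoid fun z => (N.proj z).comp
    (h.toAddMonoidHom.comp (M.piece z).subtype)).comp
      (AddEquiv.ofBijective (DirectSum.coeAddMonoidHom M.piece) M.isInternal).symm.toAddMonoidHom

theorem degreeZeroAddHom_apply {M N : GrMod 𝒜} (h : M →ₗ[R] N) {z : Γ} {x : M}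
    (hx : x ∈ M.piece z) : degreeZeroAddHom h x = N.proj z (h x) := by
  change DirectSum.toAddMonoid _
    ((AddEquiv.ofBijective (DirectSum.coeAddMonoidHom M.piece) M.isInternal).symm x) = _
  rw [symm_coe M hx, DirectSum.toAddMonoid_of]
  rfl

variable [GradedRing 𝒜]

/-- The homogeneous component of degree `0` of a linear map, as a morphism. -/
def degreeZeroPart {M N : GrMod 𝒜} (h : M →ₗ[R] N) : M ⟶ N :=
  mkHom
    { degreeZeroAddHom h with
      map_smul' := fun r x => by
        change degreeZeroAddHom h (r • x) = r • degreeZeroAddHom h x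
        induction r using DirectSum.Decomposition.inductionOn 𝒜 with
        | zero => simp
        | @homogeneous w r =>
          induction x using GrMod.induction with
          | h0 => simp
          | h1 z x hx =>
            rw [degreeZeroAddHom_apply h hx, degreeZeroAddHom_apply h (M.smul_mem r.2 hx),
              map_smul, proj_smul _ r.2]
          | h2 x y hx hy => simp only [smul_add, map_add, hx, hy]
        | add r s hr hs => simp only [add_smul, map_add, hr, hs] }
    fun z x hx => by
      change degreeZeroAddHom h x ∈ _
      rw [degreeZeroAddHom_apply h hx]
      exact N.proj_mem z _

theorem degreeZeroPart_apply {M N : GrMod 𝒜} (h : M →ₗ[R] N) {z : Γ} {x : M}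
    (hx : x ∈ M.piece z) : lin (degreeZeroPart h) x = N.proj z (h x) :=
  degreeZeroAddHom_apply h hx

/-- If a linear map extends a morphism along a morphism, then so does its component of
degree `0`. -/
theorem comp_degreeZeroPart {M N P : GrMod 𝒜} (f : M ⟶ N) (h : N →ₗ[R] P) (g : M ⟶ P)
    (w : h ∘ₗ lin f = lin g) : f ≫ degreeZeroPart h = g := by
  refine hom_ext' fun x => ?_
  induction x using GrMod.induction with
  | h0 => simp
  | h1 z x hx =>
    have := LinearMap.congr_fun w x
    rw [LinearMap.comp_apply] at this
    rw [lin_comp, LinearMap.comp_apply, degreeZeroPart_apply h (lin_mem f hx), this,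
      proj_same _ _ _ (lin_mem g hx)]
  | h2 x y hx hy => rw [map_add, map_add, hx, hy]

/-! ### Free graded modules -/

/-- A linear map which is homogeneous of degree `0` on a homogeneous generating family is
homogeneous of degree `0`. -/
theorem lin_mem_of_span {M N : GrMod 𝒜} {ι : Type*} (b : ι → M) (deg : ι → Γ)
    (hb : ∀ i, b i ∈ M.piece (deg i)) (hspan : Submodule.span R (Set.range b) = ⊤)
    (f : M →ₗ[R] N) (hf : ∀ i, f (b i) ∈ N.piece (deg i)) (d : Γ) (x : M)
    (hx : x ∈ M.piece d) : f x ∈ N.piece d := by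
  -- Homogeneity of `x` is lost in a span induction. Commuting with all projections is an equivalent
  -- condition that makes sense for every `x`.
  have key : ∀ x ∈ Submodule.span R (Set.range b), ∀ d, N.proj d (f x) = f (M.proj d x) := by
    intro x hx
    induction hx using Submodule.span_induction with
    | mem x hx =>
      obtain ⟨i, rfl⟩ := hx
      intro d
      by_cases h : d = deg i
      · subst h
        rw [proj_same _ _ _ (hb i), proj_same _ _ _ (hf i)]
      · rw [proj_ne _ _ _ _ h (hb i), proj_ne _ _ _ _ h (hf i), map_zero]
    | zero => simp
    | add x y _ _ hx hy => intro d; simp only [map_add, hx, hy]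
    | smul r x _ hx =>
      induction r using DirectSum.Decomposition.inductionOn 𝒜 with
      | zero => simp
      | @homogeneous w r =>
        intro d
        -- Degrees form a group, so every degree is a shift by `w`, the form in which `proj_smul`
        -- applies.
        obtain ⟨d, rfl⟩ : ∃ d', d = w + d' := ⟨d - w, by abel⟩
        rw [map_smul, proj_smul _ r.2, proj_smul _ r.2, map_smul, hx]
      | add r s hr hs => intro d; simp only [add_smul, map_add, hr, hs]
  apply mem_piece_of_proj_eq
  rw [key x (hspan ▸ Submodule.mem_top), proj_same _ _ _ hx]

/-- A graded module with a homogeneous basis is projective. -/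
theorem projective_of_basis {P : GrMod 𝒜} {ι : Type*} (b : Module.Basis ι R P) (deg : ι → Γ)
    (hb : ∀ i, b i ∈ P.piece (deg i)) : Projective P where
  factors {E X} f e _ := by
    have hlift : ∀ i, ∃ y ∈ E.piece (deg i), lin e y = lin f (b i) := by
      intro i
      obtain ⟨y, hy⟩ := surjective_of_epi e (lin f (b i))
      -- An arbitrary preimage need not be homogeneous; its component of degree `deg i` is still a
      -- preimage.
      refine ⟨E.proj (deg i) y, E.proj_mem _ _, ?_⟩
      rw [map_proj, hy, proj_same _ _ _ (lin_mem f (hb i))]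
    choose y hy hey using hlift
    refine ⟨mkHom (b.constr R y)
      (lin_mem_of_span b deg hb b.span_eq _ fun i => by rw [b.constr_basis]; exact hy i), ?_⟩
    apply lin_injective
    refine b.ext fun i => ?_
    rw [lin_comp, lin_mkHom, LinearMap.comp_apply, b.constr_basis, hey]

variable (𝒜) in
/-- The free graded module on generators of given degrees. -/
def free {ι : Type u} (deg : ι → Γ) : GrMod 𝒜 where
  carrier := ι →₀ R
  piece d :=
    { carrier := {f | ∀ a, f a ∈ 𝒜 (d - deg a)}
      zero_mem' := fun _ => zero_mem _
      add_mem' := fun hf hg a => add_mem (hf a) (hg a)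
      neg_mem' := fun hf a => neg_mem (hf a) }
  isInternal := by
    refine isInternal_of_proj _ ?_ (fun d => Finsupp.liftAddHom fun a =>
      (Finsupp.singleAddHom a).comp (GradedRing.proj 𝒜 (d - deg a))) ?_ ?_
    · intro f
      induction f using Finsupp.induction_linear with
      | zero => exact zero_mem _
      | add f g hf hg => exact add_mem hf hg
      | single a r =>
        induction r using DirectSum.Decomposition.inductionOn 𝒜 with
        | zero => rw [Finsupp.single_zero]; exact zero_mem _
        | @homogeneous w r =>
          refine AddSubgroup.mem_iSup_of_mem (w + deg a) fun c => ?_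
          classical
          rw [Finsupp.single_apply]
          split_ifs with h
          · subst h
            rw [add_sub_cancel_right]
            exact r.2
          · exact zero_mem _
        | add r s hr hs => rw [Finsupp.single_add]; exact add_mem hr hs
    · intro d f hf
      conv_rhs => rw [← Finsupp.sum_single f]
      refine Finsupp.sum_congr fun a _ => ?_
      change Finsupp.single a (GradedRing.proj 𝒜 (d - deg a) (f a)) = _
      rw [GradedRing.proj_apply, DirectSum.decompose_of_mem_same _ (hf a)]
    · intro d d' f h hf
      refine Finset.sum_eq_zero fun a _ => ?_
      change Finsupp.single a (GradedRing.proj 𝒜 (d - deg a) (f a)) = _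
      rw [GradedRing.proj_apply, DirectSum.decompose_of_mem_ne _ (hf a)
        (fun h' => h (sub_left_injective h').symm), Finsupp.single_zero]
  smul_mem := by
    intro i j r f hr hf a
    rw [add_sub_assoc]
    exact SetLike.mul_mem_graded hr (hf a)

/-- The basis of the free graded module. -/
def freeBasis {ι : Type u} (deg : ι → Γ) : Module.Basis ι R (free 𝒜 deg) :=
  Finsupp.basisSingleOne

theorem freeBasis_mem {ι : Type u} (deg : ι → Γ) (i : ι) :
    freeBasis deg i ∈ (free 𝒜 deg).piece (deg i) := by
  intro a
  change (Finsupp.basisSingleOne (R := R) i) a ∈ _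
  classical
  rw [Finsupp.coe_basisSingleOne, Finsupp.single_apply]
  split_ifs with h
  · subst h
    rw [sub_self]
    exact SetLike.one_mem_graded 𝒜
  · exact zero_mem _

/-- The free graded module on the homogeneous elements of `M`. -/
def cover (M : GrMod 𝒜) : GrMod 𝒜 := free 𝒜 fun a : Σ d, M.piece d => a.1

/-- The canonical morphism from the free graded module on the homogeneous elements. -/
def coverπ (M : GrMod 𝒜) : cover M ⟶ M :=
  mkHom ((freeBasis _).constr R fun a : Σ d, M.piece d => (a.2 : M))
    (lin_mem_of_span _ _ (freeBasis_mem _) (freeBasis _).span_eq _ fun i => by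
      rw [(freeBasis _).constr_basis]
      exact i.2.2)

theorem coverπ_surjective (M : GrMod 𝒜) : Function.Surjective (lin (coverπ M)) := by
  rw [← LinearMap.range_eq_top, eq_top_iff]
  intro x _
  induction x using GrMod.induction with
  | h0 => exact zero_mem _
  | h1 d x hx =>
    exact ⟨freeBasis _ ⟨d, x, hx⟩, (freeBasis _).constr_basis R _ _⟩
  | h2 x y hx hy => exact add_mem (hx trivial) (hy trivial)

end Projectives

/-! ### Comparison of `Ext` for the bigrading and the total grading -/

section SharpExt

open Abelian

variable {K : Type u} [Field K] {m n : ℕ}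

/-- The basis of `cover M` is bihomogeneous, hence homogeneous for the total degree. This keeps
dimension shifting available after regrading. -/
theorem projective_sharp_cover (M : BigradedModule K m n) : Projective (cover M).sharp := by
  let b : Module.Basis (Σ d, M.piece d) (BiPoly K m n) (cover M) := freeBasis _
  have hb : ∀ a : Σ d, M.piece d, b a ∈ (cover M).sharp.piece (a.1.1 + a.1.2) := fun a =>
    piece_le_sharp_piece (cover M) a.1 (freeBasis_mem (fun a : Σ d, M.piece d => a.1) a)
  exact projective_of_basis (P := (cover M).sharp) b _ hb

/-- Regrading by total degree is injective on `Ext`. -/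
theorem eq_zero_of_mapExactFunctor_sharp (i : ℕ) {M N : BigradedModule K m n} (e : Ext M N i)
    (he : e.mapExactFunctor (sharpFunctor K m n) = 0) : e = 0 := by
  induction i generalizing M with
  | zero =>
    obtain ⟨f, rfl⟩ := (Ext.mk₀_bijective _ _).2 e
    rw [Ext.mapExactFunctor_mk₀, Ext.mk₀_eq_zero_iff] at he
    rw [Ext.mk₀_eq_zero_iff]
    exact hom_ext' fun x => LinearMap.congr_fun (congrArg lin he) x
  | succ i ih =>
    have hP : Projective (cover M) := projective_of_basis (freeBasis _) _ (freeBasis_mem _)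
    let S : ShortComplex (BigradedModule K m n) :=
      ShortComplex.mk (kerι (coverπ M)) (coverπ M) (kerι_comp _)
    have hS : S.ShortExact := shortExact_of_lin S Subtype.val_injective (coverπ_surjective M)
      (range_lin_kerι _).ge
    -- Dimension shift along the free cover: the class is the image of a class of degree `i` on the
    -- kernel. After regrading, that class extends to the cover.
    obtain ⟨e, rfl⟩ := Ext.contravariant_sequence_exact₃ hS N e
      (have : Projective S.X₂ := hP; Ext.eq_zero_of_projective _) (add_comm 1 i)
    rw [Ext.mapExactFunctor_comp, Ext.mapExactFunctor_extClass] at he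
    obtain ⟨e', he'⟩ := Ext.contravariant_sequence_exact₁ _ _ _ _ he
    -- For `i = 0` the extension is a morphism that respects only the total degree; its component of
    -- bidegree zero is a bigraded extension. For larger `i` the Ext group of the regraded cover
    -- vanishes, so the induction hypothesis applies to the kernel.
    cases i with
    | zero =>
      obtain ⟨g, rfl⟩ := (Ext.mk₀_bijective _ _).2 e
      obtain ⟨h, rfl⟩ := (Ext.mk₀_bijective _ _).2 e'
      rw [Ext.mapExactFunctor_mk₀, Ext.mk₀_comp_mk₀] at he'
      have hw := congrArg lin ((Ext.mk₀_bijective _ _).1 he')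
      rw [← comp_degreeZeroPart (M := S.X₁) (N := S.X₂) (P := N) S.f
        (lin (M := S.X₂.sharp) (N := N.sharp) h) g
        (by exact hw), ← Ext.mk₀_comp_mk₀, ShortComplex.ShortExact.extClass_comp_assoc]
    | succ i =>
      have : Projective (S.map (sharpFunctor K m n)).X₂ := projective_sharp_cover M
      rw [Ext.eq_zero_of_projective e', Ext.comp_zero] at he'
      rw [ih e he'.symm, Ext.comp_zero]

end SharpExt

end GrMod

/-! ### The Mayer–Vietoris sequence -/

/-- A class which becomes `0` under the connecting homomorphism after restriction along a morphism
of short exact sequences extends after that restriction. -/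
theorem exists_extension_of_comp_extClass_eq_zero {C : Type*} [Category* C] [Abelian C]
    [HasExt.{u} C] {S₁ S₂ : ShortComplex C} (h₁ : S₁.ShortExact) (h₂ : S₂.ShortExact)
    (φ : S₁ ⟶ S₂) {Y : C} {i : ℕ} (e : Abelian.Ext S₂.X₁ Y i)
    (he : (Abelian.Ext.mk₀ φ.τ₃).comp (h₂.extClass.comp e (add_comm 1 i)) (zero_add (i + 1)) = 0) :
    ∃ x : Abelian.Ext S₁.X₂ Y i, (Abelian.Ext.mk₀ S₁.f).comp x (zero_add i) =
      (Abelian.Ext.mk₀ φ.τ₁).comp e (zero_add i) := by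
  apply Abelian.Ext.contravariant_sequence_exact₁ h₁ _ _ (add_comm 1 i)
  -- By naturality of the extension class, `he` says that the restricted class has zero image under
  -- the connecting map of `S₁`.
  rw [← Abelian.Ext.comp_assoc (a₁₂ := 1) _ _ _ (by lia) (by lia) (by lia)] at he ⊢
  rw [ShortComplex.ShortExact.extClass_naturality h₁ h₂ φ, he]

section MayerVietoris

open Abelian GrMod

variable {A : Type*} {Γ : Type} {R : Type u} [CommRing A] [CommRing R] [Algebra A R]
  [AddCommGroup Γ] [DecidableEq Γ] {𝒜 : Γ → Submodule A R}

namespace GrMod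

section Prod

variable (M N : GrMod 𝒜)

/-- The inclusion of the first summand. -/
def prodInl : M ⟶ M.prod N :=
  mkHom (M := M) (N := M.prod N) (LinearMap.inl R M N) fun _ _ h => ⟨h, zero_mem _⟩

/-- The inclusion of the second summand. -/
def prodInr : N ⟶ M.prod N :=
  mkHom (M := N) (N := M.prod N) (LinearMap.inr R M N) fun _ _ h => ⟨zero_mem _, h⟩

variable {M N}

/-- The morphism to a direct sum with given components. -/
def prodLift {P : GrMod 𝒜} (f : P ⟶ M) (g : P ⟶ N) : P ⟶ M.prod N :=
  mkHom (M := P) (N := M.prod N) ((lin f).prod (lin g)) fun _ _ h => ⟨lin_mem f h, lin_mem g h⟩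

theorem prodLift_eq {P : GrMod 𝒜} (f : P ⟶ M) (g : P ⟶ N) :
    prodLift f g = f ≫ prodInl M N + g ≫ prodInr M N :=
  hom_ext' fun x => Prod.ext (add_zero (lin f x)).symm (zero_add (lin g x)).symm

/-- The morphism `(x, y) ↦ f x - g y` on a direct sum. -/
def prodSub {P : GrMod 𝒜} (f : M ⟶ P) (g : N ⟶ P) : M.prod N ⟶ P :=
  mkHom (M := M.prod N) (N := P) ((lin f).coprod (-lin g)) fun _ _ h =>
    add_mem (lin_mem f h.1) (neg_mem (lin_mem g h.2))

theorem lin_prodSub {P : GrMod 𝒜} (f : M ⟶ P) (g : N ⟶ P) (x : M) (y : N) :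
    lin (prodSub f g) ((x, y) : M × N) = lin f x - lin g y :=
  (sub_eq_add_neg _ _).symm

/-- The direct sum of two morphisms. -/
def prodMap {M' N' : GrMod 𝒜} (f : M ⟶ M') (g : N ⟶ N') : M.prod N ⟶ M'.prod N' :=
  mkHom (M := M.prod N) (N := M'.prod N') ((lin f).prodMap (lin g)) fun _ _ h =>
    ⟨lin_mem f h.1, lin_mem g h.2⟩

end Prod

variable [GradedRing 𝒜]

/-- The projection of the ring onto its quotient by a homogeneous ideal. -/
def ringQuotMk (J : HomogeneousIdeal 𝒜) : R →ₗ[R] ringQuot J :=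
  Submodule.mkQ J.toIdeal

theorem ringQuotMk_surjective (J : HomogeneousIdeal 𝒜) : Function.Surjective (ringQuotMk J) :=
  Submodule.mkQ_surjective _

theorem ringQuotMk_eq_zero {J : HomogeneousIdeal 𝒜} {r : R} :
    ringQuotMk J r = 0 ↔ r ∈ J.toIdeal :=
  Submodule.Quotient.mk_eq_zero _

theorem ringQuotMap_mk {J J' : HomogeneousIdeal 𝒜} (h : J.toIdeal ≤ J'.toIdeal) (r : R) :
    lin (ringQuotMap h) (ringQuotMk J r) = ringQuotMk J' r := rfl

theorem ringQuotMap_comp {J J' J'' : HomogeneousIdeal 𝒜} (h : J.toIdeal ≤ J'.toIdeal)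
    (h' : J'.toIdeal ≤ J''.toIdeal) :
    ringQuotMap h ≫ ringQuotMap h' = ringQuotMap (h.trans h') :=
  hom_ext' fun x => by
    obtain ⟨x, rfl⟩ := ringQuotMk_surjective _ x
    rfl

/-- The complex `R/P → R/I ⊕ R/J → R/Q` for `P ⊆ I, J ⊆ Q`. -/
def mayerVietorisComplex {P I J Q : HomogeneousIdeal 𝒜} (hPI : P.toIdeal ≤ I.toIdeal)
    (hPJ : P.toIdeal ≤ J.toIdeal) (hIQ : I.toIdeal ≤ Q.toIdeal) (hJQ : J.toIdeal ≤ Q.toIdeal) :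
    ShortComplex (GrMod 𝒜) :=
  ShortComplex.mk (prodLift (ringQuotMap hPI) (ringQuotMap hPJ))
    (prodSub (ringQuotMap hIQ) (ringQuotMap hJQ)) <| hom_ext' fun x => by
      obtain ⟨x, rfl⟩ := ringQuotMk_surjective _ x
      exact (lin_prodSub (ringQuotMap hIQ) (ringQuotMap hJQ) (ringQuotMk I x)
        (ringQuotMk J x)).trans (sub_self (ringQuotMk Q x))

/-- Together with the inclusions, `hP` and `hQ` amount to $P=I\cap J$ and $Q=I+J$: the former gives
injectivity, the latter exactness in the middle. -/
theorem mayerVietoris_shortExact {P I J Q : HomogeneousIdeal 𝒜} (hPI : P.toIdeal ≤ I.toIdeal)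
    (hPJ : P.toIdeal ≤ J.toIdeal) (hIQ : I.toIdeal ≤ Q.toIdeal) (hJQ : J.toIdeal ≤ Q.toIdeal)
    (hP : I.toIdeal ⊓ J.toIdeal ≤ P.toIdeal) (hQ : Q.toIdeal ≤ I.toIdeal ⊔ J.toIdeal) :
    (mayerVietorisComplex hPI hPJ hIQ hJQ).ShortExact := by
  apply shortExact_of_lin
  · rw [injective_iff_map_eq_zero]
    intro x hx
    obtain ⟨x, rfl⟩ := ringQuotMk_surjective _ x
    exact ringQuotMk_eq_zero.mpr (hP ⟨ringQuotMk_eq_zero.mp (congrArg Prod.fst hx),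
      ringQuotMk_eq_zero.mp (congrArg Prod.snd hx)⟩)
  · intro x
    obtain ⟨x, rfl⟩ := ringQuotMk_surjective _ x
    refine ⟨((ringQuotMk I x, 0) : ringQuot I × ringQuot J), ?_⟩
    refine (lin_prodSub (ringQuotMap hIQ) (ringQuotMap hJQ) _ _).trans ?_
    rw [map_zero, sub_zero, ringQuotMap_mk]
  · rintro ⟨a, b⟩ hab
    obtain ⟨a, rfl⟩ := ringQuotMk_surjective _ a
    obtain ⟨b, rfl⟩ := ringQuotMk_surjective _ b
    have h : ringQuotMk Q (a - b) = 0 := by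
      rw [map_sub]
      exact (lin_prodSub (ringQuotMap hIQ) (ringQuotMap hJQ) (ringQuotMk I a)
        (ringQuotMk J b)).symm.trans hab
    obtain ⟨u, hu, v, hv, huv⟩ := Submodule.mem_sup.mp (hQ (ringQuotMk_eq_zero.mp h))
    -- Since $a-b=u+v$ with $u\in I$ and $v\in J$, the element $a-u=b+v$ is congruent to $a$ modulo
    -- $I$ and to $b$ modulo $J$.
    refine ⟨ringQuotMk P (a - u), Prod.ext ?_ ?_⟩
    · change ringQuotMk I (a - u) = ringQuotMk I a
      rw [map_sub, ringQuotMk_eq_zero.mpr hu, sub_zero]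
    · change ringQuotMk J (a - u) = ringQuotMk J b
      rw [show a - u = b + v by rw [sub_eq_iff_eq_add, add_assoc, add_comm v, huv]; abel, map_add,
        ringQuotMk_eq_zero.mpr hv, add_zero]

/-- Functoriality of the complex `R/P → R/I ⊕ R/J → R/Q`. -/
def mayerVietorisMap {P I J Q P' I' J' Q' : HomogeneousIdeal 𝒜} (hPI : P.toIdeal ≤ I.toIdeal)
    (hPJ : P.toIdeal ≤ J.toIdeal) (hIQ : I.toIdeal ≤ Q.toIdeal) (hJQ : J.toIdeal ≤ Q.toIdeal)
    (hPI' : P'.toIdeal ≤ I'.toIdeal) (hPJ' : P'.toIdeal ≤ J'.toIdeal)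
    (hIQ' : I'.toIdeal ≤ Q'.toIdeal) (hJQ' : J'.toIdeal ≤ Q'.toIdeal)
    (hP : P.toIdeal ≤ P'.toIdeal) (hI : I.toIdeal ≤ I'.toIdeal) (hJ : J.toIdeal ≤ J'.toIdeal)
    (hQ : Q.toIdeal ≤ Q'.toIdeal) :
    mayerVietorisComplex hPI hPJ hIQ hJQ ⟶ mayerVietorisComplex hPI' hPJ' hIQ' hJQ' where
  τ₁ := ringQuotMap hP
  τ₂ := prodMap (ringQuotMap hI) (ringQuotMap hJ)
  τ₃ := ringQuotMap hQ
  comm₁₂ := hom_ext' fun x => by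
    obtain ⟨x, rfl⟩ := ringQuotMk_surjective _ x
    rfl
  comm₂₃ := hom_ext' fun x => by
    obtain ⟨a, b⟩ := x
    obtain ⟨a, rfl⟩ := ringQuotMk_surjective _ a
    obtain ⟨b, rfl⟩ := ringQuotMk_surjective _ b
    have h1 := congrArg (lin (ringQuotMap hQ))
      (lin_prodSub (ringQuotMap hIQ) (ringQuotMap hJQ) (ringQuotMk I a) (ringQuotMk J b))
    have h2 := lin_prodSub (ringQuotMap hIQ') (ringQuotMap hJQ') (ringQuotMk I' a)
      (ringQuotMk J' b)
    rw [map_sub] at h1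
    exact h2.trans h1.symm

end GrMod

variable [GradedRing 𝒜]

theorem homogeneousPow_antitone (I : HomogeneousIdeal 𝒜) {a b : ℕ} (h : a ≤ b) :
    (homogeneousPow I b).toIdeal ≤ (homogeneousPow I a).toIdeal :=
  Ideal.pow_le_pow_right h

/-- This turns vanishing of a colimit into a statement about individual Ext classes at finite
stages, the only form in which local cohomology is used below. -/
theorem subsingleton_gradedLocalCohomology_iff (I : HomogeneousIdeal 𝒜) (i : ℕ) (M : GrMod 𝒜)
    (γ : Γ) : Subsingleton (gradedLocalCohomology I i M γ) ↔
      ∀ (n : ℕ) (e : Ext (ringQuot (homogeneousPow I n)) (M.twist γ) i), ∃ (k : ℕ) (h : n ≤ k),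
        (Ext.mk₀ (ringQuotMap (homogeneousPow_antitone I h))).comp e (zero_add i) = 0 := by
  refine (subsingleton_colimit_iff _).trans (forall_congr' fun n => forall_congr' fun e => ?_)
  exact ⟨fun ⟨k, h, hk⟩ => ⟨k, leOfHom h, hk⟩, fun ⟨k, h, hk⟩ => ⟨k, homOfLE h, hk⟩⟩

/-- Vanishing from the Mayer–Vietoris sequence: if `Pⁿ = Iⁿ ∩ Jⁿ` for all `n`, then `H^i_P(M)`
vanishes when `H^i_I(M)`, `H^i_J(M)` and the colimit of `Ext^{i+1}(R/(Iⁿ + Jⁿ), M)` do. -/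
theorem subsingleton_of_mayerVietoris {P I J : HomogeneousIdeal 𝒜} {Q : ℕ → HomogeneousIdeal 𝒜}
    (hP : ∀ n, P.toIdeal ^ n = I.toIdeal ^ n ⊓ J.toIdeal ^ n)
    (hQ : ∀ n, (Q n).toIdeal = I.toIdeal ^ n ⊔ J.toIdeal ^ n) (hQa : ∀ {n k}, n ≤ k →
      (Q k).toIdeal ≤ (Q n).toIdeal) (i : ℕ) (M : GrMod 𝒜) (γ : Γ)
    (hI : Subsingleton (gradedLocalCohomology I i M γ))
    (hJ : Subsingleton (gradedLocalCohomology J i M γ))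
    (hIJ : ∀ (n : ℕ) (e : Ext (ringQuot (Q n)) (M.twist γ) (i + 1)), ∃ (k : ℕ) (h : n ≤ k),
      (Ext.mk₀ (ringQuotMap (hQa h))).comp e (zero_add (i + 1)) = 0) :
    Subsingleton (gradedLocalCohomology P i M γ) := by
  rw [subsingleton_gradedLocalCohomology_iff] at hI hJ ⊢
  have hPI : ∀ n, (homogeneousPow P n).toIdeal ≤ (homogeneousPow I n).toIdeal := fun n =>
    (hP n).trans_le inf_le_left
  have hPJ : ∀ n, (homogeneousPow P n).toIdeal ≤ (homogeneousPow J n).toIdeal := fun n =>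
    (hP n).trans_le inf_le_right
  have hIQ : ∀ n, (homogeneousPow I n).toIdeal ≤ (Q n).toIdeal := fun n =>
    le_sup_left.trans_eq (hQ n).symm
  have hJQ : ∀ n, (homogeneousPow J n).toIdeal ≤ (Q n).toIdeal := fun n =>
    le_sup_right.trans_eq (hQ n).symm
  have hS : ∀ n, (mayerVietorisComplex (hPI n) (hPJ n) (hIQ n) (hJQ n)).ShortExact := fun n =>
    mayerVietoris_shortExact _ _ _ _ (hP n).ge (hQ n).le
  intro n e
  -- The boundary of `e` dies at stage `k`, so there the restriction of `e` comes from a class `x`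
  -- on the direct sum.
  obtain ⟨k, hnk, hk⟩ := hIJ n ((hS n).extClass.comp e (add_comm 1 i))
  obtain ⟨x, hx⟩ : ∃ x : Ext ((ringQuot (homogeneousPow I k)).prod (ringQuot (homogeneousPow J k)))
      (M.twist γ) i, (Ext.mk₀ (prodLift (ringQuotMap (hPI k)) (ringQuotMap (hPJ k)))).comp x
        (zero_add i) = (Ext.mk₀ (ringQuotMap (homogeneousPow_antitone P hnk))).comp e (zero_add i) :=
    exists_extension_of_comp_extClass_eq_zero (hS k) (hS n)
      (mayerVietorisMap (hPI k) (hPJ k) (hIQ k) (hJQ k) (hPI n) (hPJ n) (hIQ n) (hJQ n)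
        (homogeneousPow_antitone P hnk) (homogeneousPow_antitone I hnk) (homogeneousPow_antitone J hnk) (hQa hnk)) e hk
  -- The two components of `x` die at possibly different stages; the maximum serves both.
  obtain ⟨k₁, hk₁, h₁⟩ := hI k ((Ext.mk₀ (prodInl _ _)).comp x (zero_add i))
  obtain ⟨k₂, hk₂, h₂⟩ := hJ k ((Ext.mk₀ (prodInr _ _)).comp x (zero_add i))
  have hPl : ∀ {L : HomogeneousIdeal 𝒜} (_ : ∀ n, (homogeneousPow P n).toIdeal ≤
      (homogeneousPow L n).toIdeal) {a b : ℕ}, a ≤ b →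
      (homogeneousPow P b).toIdeal ≤ (homogeneousPow L a).toIdeal :=
    fun h a b hab => (h b).trans (homogeneousPow_antitone _ hab)
  have hl : k ≤ max k₁ k₂ := hk₁.trans (le_max_left _ _)
  have hcomp : ringQuotMap (homogeneousPow_antitone P hl) ≫ prodLift (ringQuotMap (hPI k)) (ringQuotMap (hPJ k)) =
      ringQuotMap (hPl hPI (le_max_left k₁ k₂)) ≫ ringQuotMap (homogeneousPow_antitone I hk₁) ≫ prodInl _ _ +
      ringQuotMap (hPl hPJ (le_max_right k₁ k₂)) ≫ ringQuotMap (homogeneousPow_antitone J hk₂) ≫ prodInr _ _ := by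
    rw [prodLift_eq, Preadditive.comp_add]
    simp only [← Category.assoc, ringQuotMap_comp]
  refine ⟨max k₁ k₂, hnk.trans hl, ?_⟩
  rw [← ringQuotMap_comp (homogeneousPow_antitone P hl) (homogeneousPow_antitone P hnk), ← Ext.mk₀_comp_mk₀_assoc]
  rw [← hx, Ext.mk₀_comp_mk₀_assoc, hcomp]
  simp only [Ext.mk₀_add, Ext.add_comp, ← Ext.mk₀_comp_mk₀_assoc]
  rw [h₁, h₂, Ext.comp_zero, Ext.comp_zero, add_zero]

end MayerVietoris

/-! ### Powers of ideals generated by variables -/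

section Ideals

open MvPolynomial

variable {k : Type*} [CommRing k] {σ ι : Type*} [Fintype ι]

/-- Each monomial of a product is a product of monomials of the factors, and every factor from the
ideal contributes at least one variable `v i`. -/
theorem le_sum_of_mem_span_X_pow (v : ι → σ) {d : ℕ}
    {f : MvPolynomial σ k} (hf : f ∈ Ideal.span (Set.range fun i => X (R := k) (v i)) ^ d) :
    ∀ s ∈ f.support, d ≤ ∑ i, s (v i) := by
  classical
  induction d generalizing f with
  | zero => exact fun _ _ => Nat.zero_le _
  | succ d ih =>
    rw [pow_succ] at hf
    induction hf using Submodule.mul_induction_on' with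
    | mem_mul_mem a ha b hb =>
      intro s hs
      obtain ⟨s₁, hs₁, s₂, hs₂, rfl⟩ := Finset.mem_add.mp (support_mul a b hs)
      have hb' : b ∈ Ideal.span (X '' Set.range v) := by
        rwa [← Set.range_comp]
      obtain ⟨_, ⟨i, rfl⟩, hi⟩ := mem_ideal_span_X_image.mp hb' s₂ hs₂
      simp only [Finsupp.add_apply, Finset.sum_add_distrib]
      exact add_le_add (ih ha s₁ hs₁) ((Nat.one_le_iff_ne_zero.mpr hi).trans
        (Finset.single_le_sum (f := fun i => s₂ (v i)) (fun _ _ => Nat.zero_le _)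
          (Finset.mem_univ i)))
    | add a _ b _ ha hb =>
      intro s hs
      rcases Finset.mem_union.mp (support_add hs) with h | h
      · exact ha s h
      · exact hb s h

theorem prod_X_pow_mem (v : ι → σ) (s : σ →₀ ℕ) {d : ℕ} (hd : d ≤ ∑ i, s (v i)) :
    ∏ i, X (R := k) (v i) ^ s (v i) ∈ Ideal.span (Set.range fun i => X (R := k) (v i)) ^ d := by
  refine Ideal.pow_le_pow_right hd ?_
  rw [← Finset.prod_pow_eq_pow_sum]
  exact Ideal.prod_mem_prod fun i _ =>
    Ideal.pow_mem_pow (Ideal.subset_span (Set.mem_range_self i)) _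

variable {K : Type u} [Field K] {m n : ℕ}

theorem idealXmulY_eq_mul : (idealXmulY K m n).toIdeal =
    (idealX K m n).toIdeal * (idealY K m n).toIdeal := by
  change Ideal.span _ = Ideal.span _ * Ideal.span _
  rw [Ideal.span_mul_span']
  congr 1
  ext f
  simp only [Set.mem_range, Set.mem_mul, Prod.exists, exists_exists_eq_and]

theorem idealXandY_eq_sup : (idealXandY K m n).toIdeal =
    (idealX K m n).toIdeal ⊔ (idealY K m n).toIdeal := by
  change Ideal.span _ = Ideal.span _ ⊔ Ideal.span _
  rw [← Ideal.span_union]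
  congr 1
  ext f
  simp only [Set.mem_range, Set.mem_union, Sum.exists]

/-- Both powers are monomial ideals. A monomial in the intersection has $x$-degree and $y$-degree at
least $d$, and as the variables are disjoint it splits into an $x$-part in $(x)^d$ and a $y$-part in
$(y)^d$. -/
theorem idealXmulY_pow (d : ℕ) : (idealXmulY K m n).toIdeal ^ d =
    (idealX K m n).toIdeal ^ d ⊓ (idealY K m n).toIdeal ^ d := by
  rw [idealXmulY_eq_mul, mul_pow]
  refine le_antisymm Ideal.mul_le_inf ?_
  rintro f ⟨hx, hy⟩
  rw [f.as_sum]
  refine Ideal.sum_mem _ fun s hs => ?_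
  have h : monomial s (coeff s f) = C (coeff s f) *
      ((∏ i, X (Sum.inl i) ^ s (Sum.inl i)) * ∏ j, X (Sum.inr j) ^ s (Sum.inr j)) := by
    rw [monomial_eq, Finsupp.prod_fintype _ _ (fun _ => pow_zero _), Fintype.prod_sum_type]
  rw [h]
  exact Ideal.mul_mem_left _ _ (Ideal.mul_mem_mul
    (prod_X_pow_mem Sum.inl s (le_sum_of_mem_span_X_pow Sum.inl hx s hs))
    (prod_X_pow_mem Sum.inr s (le_sum_of_mem_span_X_pow Sum.inr hy s hs)))

end Ideals

/-! ### Comparison of local cohomology for the bigrading and the total grading -/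

section Comparison

open Abelian GrMod

variable {K : Type u} [Field K] {m n : ℕ}

theorem bigrading_le_totalGrading (z : ℤ × ℤ) :
    bigrading K m n z ≤ totalGrading K m n (z.1 + z.2) := by
  intro f hf s hs
  rw [← weight_bidegree, hf hs]

theorem monomial_mem_bigrading (s : Fin (m + 1) ⊕ Fin (n + 1) →₀ ℕ) (a : K) :
    MvPolynomial.monomial s a ∈ bigrading K m n (Finsupp.weight (bidegree m n) s) :=
  MvPolynomial.isWeightedHomogeneous_monomial _ _ _ rfl

/-- The regraded quotient ring, compared with the quotient for the total grading. -/
def sharpRingQuotHom {J : HomogeneousIdeal (bigrading K m n)}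
    {J' : HomogeneousIdeal (totalGrading K m n)} (h : J.toIdeal ≤ J'.toIdeal) :
    (ringQuot J).sharp ⟶ ringQuot J' :=
  mkHom (M := (ringQuot J).sharp) (N := ringQuot J')
    (Submodule.mapQ J.toIdeal J'.toIdeal LinearMap.id h) fun d x hx =>
    sharp_piece_le (M := ringQuot J) (P := ((ringQuot J').piece d).comap
      (Submodule.mapQ J.toIdeal J'.toIdeal LinearMap.id h).toAddMonoidHom) (fun z hz => by
        rintro _ ⟨r, hr, rfl⟩
        subst hz
        exact ⟨r, bigrading_le_totalGrading z hr, rfl⟩) hx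

/-- The quotient for the total grading, compared with the regraded quotient ring. -/
def ringQuotSharpHom {J : HomogeneousIdeal (bigrading K m n)}
    {J' : HomogeneousIdeal (totalGrading K m n)} (h : J'.toIdeal ≤ J.toIdeal) :
    ringQuot J' ⟶ (ringQuot J).sharp :=
  mkHom (M := ringQuot J') (N := (ringQuot J).sharp)
    (Submodule.mapQ J'.toIdeal J.toIdeal LinearMap.id h) <| by
    rintro d _ ⟨r, hr, rfl⟩
    change ringQuotMk J r ∈ (ringQuot J).sharp.piece d
    -- `r` is homogeneous only for the total degree, but each of its monomials is bihomogeneous.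
    rw [r.as_sum, map_sum]
    refine AddSubgroup.sum_mem _ fun s hs => ?_
    have hs' : Finsupp.weight (fun _ => (1 : ℤ)) s = d := hr (MvPolynomial.mem_support_iff.mp hs)
    rw [← hs', ← weight_bidegree]
    exact piece_le_sharp_piece (ringQuot J) _ ⟨_, monomial_mem_bigrading s _, rfl⟩

/-- Translation by `γ` carries the bidegrees of total degree `d` bijectively onto those of total
degree `γ.1 + γ.2 + d`. -/
theorem piece_twist_sharp (M : BigradedModule K m n) (γ : ℤ × ℤ) (d : ℤ) :
    (M.twist γ).sharp.piece d = (M.sharp.twist (γ.1 + γ.2)).piece d := by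
  apply le_antisymm
  · refine sharp_piece_le (M := M.twist γ) fun z hz => ?_
    subst hz
    have h := piece_le_sharp_piece M (γ + z)
    have e : (γ + z).1 + (γ + z).2 = γ.1 + γ.2 + (z.1 + z.2) := by
      rw [Prod.fst_add, Prod.snd_add]; ring
    rw [e] at h
    exact h
  · refine sharp_piece_le (M := M) (d := γ.1 + γ.2 + d) fun z hz => ?_
    have h := piece_le_sharp_piece (M.twist γ) (z - γ)
    have e : (z - γ).1 + (z - γ).2 = d := by
      rw [Prod.fst_sub, Prod.snd_sub]; linarith
    rw [e] at h
    refine le_trans (le_of_eq ?_) h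
    exact congrArg M.piece (add_sub_cancel γ z).symm

/-- Regrading commutes with twists. -/
def twistSharpIso (M : BigradedModule K m n) (γ : ℤ × ℤ) :
    (M.twist γ).sharp ≅ M.sharp.twist (γ.1 + γ.2) where
  hom := mkHom (M := (M.twist γ).sharp) (N := M.sharp.twist (γ.1 + γ.2)) LinearMap.id
    fun d _ hx => (piece_twist_sharp M γ d).le hx
  inv := mkHom (M := M.sharp.twist (γ.1 + γ.2)) (N := (M.twist γ).sharp) LinearMap.id
    fun d _ hx => (piece_twist_sharp M γ d).ge hx
  hom_inv_id := rfl
  inv_hom_id := rfl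

/-- If `H^i_{(x,y)}(M^♯)` vanishes in degree `|γ|`, then every class in `Ext^i(R/(x,y)ⁿ, M(γ))`
for the bigrading dies in some `Ext^i(R/(x,y)ᵏ, M(γ))`. -/
theorem exists_restriction_eq_zero_of_sharp {Q : HomogeneousIdeal (bigrading K m n)}
    {Q' : HomogeneousIdeal (totalGrading K m n)} (hQ : Q.toIdeal = Q'.toIdeal) (i : ℕ)
    (M : BigradedModule K m n) (γ : ℤ × ℤ)
    (h : Subsingleton (gradedLocalCohomology Q' i M.sharp (γ.1 + γ.2)))
    (d : ℕ) (e : Ext (ringQuot (homogeneousPow Q d)) (M.twist γ) i) :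
    ∃ (k : ℕ) (h : d ≤ k), (Ext.mk₀ (ringQuotMap
      (homogeneousPow_antitone Q h))).comp e (zero_add i) = 0 := by
  rw [subsingleton_gradedLocalCohomology_iff] at h
  have hpow : ∀ d, (homogeneousPow Q d).toIdeal = (homogeneousPow Q' d).toIdeal := fun d =>
    congrArg (· ^ d) hQ
  let F := sharpFunctor K m n
  let e' : Ext (ringQuot (homogeneousPow Q d)).sharp (M.twist γ).sharp i := e.mapExactFunctor F
  obtain ⟨k, hk, h⟩ := h d ((Ext.mk₀ (ringQuotSharpHom (hpow d).ge)).comp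
    (e'.comp (Ext.mk₀ (twistSharpIso M γ).hom) (add_zero i)) (zero_add i))
  refine ⟨k, hk, eq_zero_of_mapExactFunctor_sharp i _ ?_⟩
  rw [Ext.mapExactFunctor_comp, Ext.mapExactFunctor_mk₀]
  let t : (ringQuot (homogeneousPow Q k)).sharp ⟶ (ringQuot (homogeneousPow Q d)).sharp :=
    F.map (ringQuotMap (homogeneousPow_antitone Q hk))
  change (Ext.mk₀ t).comp e' (zero_add i) = 0
  -- The regraded restriction map factors through the restriction map of total-degree quotients,
  -- along which the class dies.
  have ht : t = sharpRingQuotHom (hpow k).le ≫ ringQuotMap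
      (homogeneousPow_antitone Q' hk) ≫ ringQuotSharpHom (hpow d).ge :=
    hom_ext' fun x => by
      obtain ⟨x, rfl⟩ := ringQuotMk_surjective (homogeneousPow Q k) x
      rfl
  have h0 : (Ext.mk₀ t).comp (e'.comp (Ext.mk₀ (twistSharpIso M γ).hom) (add_zero i))
      (zero_add i) = 0 := by
    rw [ht, ← Ext.mk₀_comp_mk₀_assoc, ← Ext.mk₀_comp_mk₀_assoc, h, Ext.comp_zero]
  -- The twist isomorphism is undone, so vanishing passes from $M^\sharp(|\gamma|)$ back to
  -- $M(\gamma)^\sharp$.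
  have h1 : e' = (e'.comp (Ext.mk₀ (twistSharpIso M γ).hom) (add_zero i)).comp
      (Ext.mk₀ (twistSharpIso M γ).inv) (add_zero i) := by
    rw [Ext.comp_assoc_of_third_deg_zero, Ext.mk₀_comp_mk₀, Iso.hom_inv_id, Ext.comp_mk₀_id]
  rw [h1, ← Ext.comp_assoc_of_third_deg_zero, h0, Ext.zero_comp]

/-- Vanishing of local cohomology with support in `(xy)` in terms of the supports `(x)`, `(y)`
and `(x, y)`. -/
theorem subsingleton_idealXmulY (M : BigradedModule K m n) (i : ℕ) (k k' : ℤ)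
    (hx : Subsingleton (gradedLocalCohomology (idealX K m n) i M (k, k')))
    (hy : Subsingleton (gradedLocalCohomology (idealY K m n) i M (k, k')))
    (hxy : Subsingleton (gradedLocalCohomology (idealXandY K m n) (i + 1) M.sharp (k + k'))) :
    Subsingleton (gradedLocalCohomology (idealXmulY K m n) i M (k, k')) := by
  let I := idealX K m n
  let J := idealY K m n
  let Q : HomogeneousIdeal (bigrading K m n) := I ⊔ J
  have hQ : Q.toIdeal = I.toIdeal ⊔ J.toIdeal := HomogeneousIdeal.toIdeal_sup I J
  let L : ℕ → HomogeneousIdeal (bigrading K m n) := fun d =>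
    homogeneousPow I d ⊔ homogeneousPow J d
  have hL : ∀ d, (L d).toIdeal = I.toIdeal ^ d ⊔ J.toIdeal ^ d := fun d =>
    HomogeneousIdeal.toIdeal_sup _ _
  have hLa : ∀ {a b : ℕ}, a ≤ b → (L b).toIdeal ≤ (L a).toIdeal := fun {a b} h => by
    rw [hL, hL]
    exact sup_le_sup (Ideal.pow_le_pow_right h) (Ideal.pow_le_pow_right h)
  have hLQ : ∀ d, (L d).toIdeal ≤ (homogeneousPow Q d).toIdeal := fun d => by
    rw [hL]
    change _ ≤ Q.toIdeal ^ d
    rw [hQ]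
    exact sup_le (Ideal.pow_right_mono le_sup_left d) (Ideal.pow_right_mono le_sup_right d)
  -- A product of `2d` elements, each from $I$ or $J$, has at least `d` factors in one of them. With
  -- `hLQ` this makes $I^d+J^d$ cofinal with the powers of $I+J$.
  have hQL : ∀ d, (homogeneousPow Q (d + d)).toIdeal ≤ (L d).toIdeal := fun d => by
    rw [hL]
    change Q.toIdeal ^ (d + d) ≤ _
    rw [hQ]
    exact Ideal.sup_pow_add_le_pow_sup_pow
  refine subsingleton_of_mayerVietoris (I := I) (J := J) (Q := L) idealXmulY_pow hL hLa i M _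
    hx hy fun d e => ?_
  obtain ⟨c, hc, h⟩ := exists_restriction_eq_zero_of_sharp (hQ.trans idealXandY_eq_sup.symm)
    (i + 1) M (k, k') hxy (d + d) ((Ext.mk₀ (ringQuotMap (hQL d))).comp e (zero_add _))
  have hdc : d ≤ c := (Nat.le_add_right d d).trans hc
  refine ⟨c, hdc, ?_⟩
  rw [Ext.mk₀_comp_mk₀_assoc, ringQuotMap_comp] at h
  rw [← ringQuotMap_comp (hLQ c) ((homogeneousPow_antitone Q hc).trans (hQL d)),
    ← Ext.mk₀_comp_mk₀_assoc, h, Ext.comp_zero]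

end Comparison

/-! ### Regions -/

theorem mem_Reg_zero {p p' k k' : ℤ} (h : (k, k') ∈ Reg 0 p p') : p ≤ k ∧ p' ≤ k' := by
  simp only [Reg, StAt, St, le_refl, if_true, lt_irrefl, if_false, Set.mem_ofPred_eq] at h
  obtain ⟨a, b, ha, hb, _, ⟨s, ⟨h1, h2, h3⟩, rfl⟩, h⟩ := h
  simp only [Prod.ext_iff, Prod.fst_add, Prod.snd_add] at h
  omega

/-- On the staircase $r+s=-i-1$ with $r,s\le -1$, so each coordinate is at least $-i$. -/
theorem mem_Reg_of_pos {i p p' k k' : ℤ} (hi : 0 < i) (h : (k, k') ∈ Reg i p p') :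
    p - i ≤ k ∧ p' - i ≤ k' ∧ p + p' - i - 1 ≤ k + k' := by
  simp only [Reg, StAt, St, hi.le, hi, if_true, Set.mem_ofPred_eq] at h
  obtain ⟨a, b, ha, hb, _, ⟨s, ⟨h1, h2, h3⟩, rfl⟩, h⟩ := h
  simp only [Prod.ext_iff, Prod.fst_add, Prod.snd_add] at h
  omega

/-- As $St_0=\{(0,0)\}$, the exceptional region for index $-1$ is an ordinary quadrant, so part (a)
covers it. -/
theorem Reg_neg_one (p p' : ℤ) : Reg (-1) p p' ⊆ Reg 0 (p + 1) (p' + 1) := by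
  rintro ⟨k, k'⟩ h
  simp only [Reg, StAt, St, le_refl, if_true, lt_irrefl, if_false, Set.mem_ofPred_eq,
    show ¬ (0 : ℤ) ≤ -1 by norm_num] at h ⊢
  obtain ⟨a, b, ha, hb, h⟩ := h
  exact ⟨a, b, ha, hb, _, ⟨0, by simp, (add_zero _).symm⟩, h⟩

/-! ### Degree bookkeeping and the conclusion. -/

section Vanishing

variable {K : Type u} [Field K] {m n : ℕ} {M : BigradedModule K m n} {d : ℕ} {p p' : ℤ}

/-- The third bound has no `+ 1` because the condition on $(x,y)$ is used in cohomological degree `i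
+ 1`. -/
theorem SatisfiesVC.subsingleton (h : SatisfiesVC M d p p') {i : ℕ} {k k' : ℤ}
    (hk : p + d + 1 - i ≤ k) (hk' : p' + d + 1 - i ≤ k') (hkk' : p + p' + d - i ≤ k + k') :
    Subsingleton (gradedLocalCohomology (idealXmulY K m n) i M (k, k')) :=
  subsingleton_idealXmulY M i k k' ((h i).1 k k' hk) ((h i).2.1 k k' hk')
    ((h (i + 1)).2.2 k k' (by push_cast; linarith))

theorem SatisfiesVC.subsingleton_of_le (h : SatisfiesVC M d p p') {i : ℕ} (hi : i ≤ d + 2)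
    {k k' : ℤ} (hk : (k, k') ∈ Reg 0 (p + d + 1 - i) (p' + d + 1 - i)) :
    Subsingleton (gradedLocalCohomology (idealXmulY K m n) i M (k, k')) := by
  obtain ⟨h1, h2⟩ := mem_Reg_zero hk
  -- Adding the two bounds gives $k+k'\ge p+p'+2(d+1-i)$, which is at least $p+p'+d-i$ exactly when
  -- $i\le d+2$.
  exact h.subsingleton h1 h2 (by omega)

theorem SatisfiesVC.subsingleton_of_ge (h : SatisfiesVC M d p p') {i : ℕ} (hi : d + 2 ≤ i)
    {k k' : ℤ} (hk : (k, k') ∈ Reg ((i : ℤ) - d - 1) p p') :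
    Subsingleton (gradedLocalCohomology (idealXmulY K m n) i M (k, k')) := by
  -- The index $i-d-1$ is positive, and substituting it yields exactly the three required bounds.
  obtain ⟨h1, h2, h3⟩ := mem_Reg_of_pos (by omega) hk
  exact h.subsingleton (by omega) (by omega) (by omega)

/-- With $d=0$, the cases $i=0,1$ (regions of index $-1$ and $0$) come from (a), and $i\ge 2$ from
(b). -/
theorem IsStronglyRegular.isWeaklyRegular (h : IsStronglyRegular M p p') :
    IsWeaklyRegular M p p' := by
  intro i k k' hk
  match i, hk with
  | 0, hk =>
    refine SatisfiesVC.subsingleton_of_le h (Nat.zero_le _) ?_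
    simpa using Reg_neg_one p p' (by simpa using hk)
  | 1, hk =>
    refine SatisfiesVC.subsingleton_of_le h (by omega) ?_
    simpa using hk
  | i + 2, hk =>
    refine SatisfiesVC.subsingleton_of_ge h (by omega) ?_
    simpa using hk

end Vanishing

theorem corollaryP {K : Type u} [Field K] (m n : ℕ) (M : BigradedModule K m n) (p p' : ℤ) :
    (∀ d : ℕ, SatisfiesVC M d p p' →
      (∀ i : ℕ, i ≤ d + 2 → ∀ k k' : ℤ,
        (k, k') ∈ Reg 0 (p + d + 1 - i) (p' + d + 1 - i) →
          Subsingleton (gradedLocalCohomology (idealXmulY K m n) i M (k, k'))) ∧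
      (∀ i : ℕ, d + 2 ≤ i → ∀ k k' : ℤ,
        (k, k') ∈ Reg ((i : ℤ) - d - 1) p p' →
          Subsingleton (gradedLocalCohomology (idealXmulY K m n) i M (k, k')))) ∧
    (IsStronglyRegular M p p' → IsWeaklyRegular M p p') :=
  ⟨fun _ h => ⟨fun _ hi _ _ hk => h.subsingleton_of_le hi hk,
    fun _ hi _ _ hk => h.subsingleton_of_ge hi hk⟩, fun h => h.isWeaklyRegular⟩
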